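/- Let $\Theta\subseteq\mathbb R$ be a non-degenerate closed interval (the real line, a closed half-line, or a compact interval with non-empty interior) and let $\mathbb R_+=[0,\infty)$. Let $n$ be a random variable with values in $\{1,2,\dots\}$ and $\mathbb P(n=k)>0$ for every $k\ge 1$. For every $n$ let $\mathcal H_n=\{H_{j,2l-1}: 1\le j\le n+1,\ 1\le l\le 2^{j-1}\}$ be a collection of probability measures on $\Theta$, each absolutely continuous with respect to Lebesgue measure and with full support on $\Theta$ (the collection may depend on $n$). Let $P_\eta$ be a probability measure on $\mathbb R_+$ with full support. Let $G$ be a random probability measure on $\Theta\times\mathbb R_+$ such that, given $n$, $G\sim\mathrm{DSBASp}(n,\mathcal H_n,\eta)$ (the parsimonious discrete sequential-barycenter-array location-scale random measure), that is, given $n$ there are random variables $\mu_{j,l}$ ($1\le j\le n+1$, $1\le l\le 2^j-1$) in $\Theta$ and $\phi_1,\dots,\phi_{2^n}$ in $\mathbb R_+$ such that, with $\mu_{j,0}=\inf\Theta$ and $\mu_{j,2^j}=\sup\Theta$: (i) $\mu_{1,1}\sim H_{1,1}$; (ii) $\mu_{j,2l}=\mu_{j-1,l}$ almost surely for $2\le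 j\le n+1$ and $1\le l\le 2^{j-1}-1$; (iii) for $2\le j\le n+1$, given the rows up to level $j-1$, the variables $\mu_{j,2l-1}$, $1\le l\le 2^{j-1}$, are independent, and $\mu_{j,2l-1}$ has the law $H_{j,2l-1}$ conditioned on the interval $(\mu_{j-1,l-1},\mu_{j-1,l}]$; (iv) $\phi_1,\dots,\phi_{2^n}$ are i.i.d. with law $P_\eta$ and independent of the array $(\mu_{j,l})$; (v) almost surely $G=\sum_{l=1}^{2^n}w_{n,l}\,\delta_{(\mu_{n+1,2l-1},\phi_l)}$ with $w_{n,l}=F_{n,l}-F_{n,l-1}$, where $F_{j,0}=0$, $F_{j,2^j}=1$, $F_{1,1}=\frac{\mu_{2,3}-\mu_{2,2}}{\mu_{2,3}-\mu_{2,1}}$ and, for $2\le j\le n$, $F_{j,2l}=F_{j-1,l}$ and $$F_{j,2l-1}=F_{j-1,l-1}+(F_{j-1,l}-F_{j-1,l-1})\,\frac{\mu_{j+1,4l-1}-\mu_{j+1,4l-2}}{\mu_{j+1,4l-1}-\mu_{j+1,4l-3}},\qquad \tfrac00:=1 .$$ Then the support of the law of $G$ under the weak topology is the whole space $\mathcal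 P(\Theta\times\mathbb R_+)$ of probability measures on $\Theta\times\mathbb R_+$: every weak neighbourhood of every $G_0\in\mathcal P(\Theta\times\mathbb R_+)$ contains $G$ with positive probability. -/

import Mathlib

open MeasureTheory ProbabilityTheory
open scoped NNReal ENNReal

noncomputable section

/-- A row of level `j` of an array with entries in `Θ`: the entries `μ_{j,1}, …, μ_{j,2^j-1}`. -/
abbrev SBARow (Θ : Set ℝ) (j : ℕ) : Type := Finset.Icc 1 (2 ^ j - 1) → Θ

/-- The level `j` row `(μ_{j,1}, …, μ_{j,2^j-1})` of a random array `μ`. -/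
def sbaRow {Θ : Set ℝ} {Ω : Type*} (μ : ℕ → ℕ → Ω → Θ) (j : ℕ) (ω : Ω) : SBARow Θ j :=
  fun l => μ j l ω

/-- The new entries `(μ_{j,2l-1})`, `l = 1, …, 2^(j-1)`, of the level `j` row of a random array. -/
def sbaNewEntries {Θ : Set ℝ} {Ω : Type*} (μ : ℕ → ℕ → Ω → Θ) (j : ℕ) (ω : Ω) :
    Finset.Icc 1 (2 ^ (j - 1)) → Θ :=
  fun l => μ j (2 * (l : ℕ) - 1) ω

/-- The node `μ_{j,l}`, `0 ≤ l ≤ 2^j`, of a level `j` row, as an extended real number, with the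
convention `μ_{j,0} = inf Θ` and `μ_{j,2^j} = sup Θ`. -/
def sbaNode {Θ : Set ℝ} {j : ℕ} (x : SBARow Θ j) (l : ℕ) : EReal :=
  if h : l ∈ Finset.Icc 1 (2 ^ j - 1) then ((x ⟨l, h⟩ : ℝ) : EReal)
  else if l = 0 then ⨅ t : Θ, ((t : ℝ) : EReal) else ⨆ t : Θ, ((t : ℝ) : EReal)

/-- The interval `(μ_{j,l-1}, μ_{j,l}]` of `Θ`, for `1 ≤ l ≤ 2^j`. -/
def sbaCell {Θ : Set ℝ} {j : ℕ} (x : SBARow Θ j) (l : ℕ) : Set Θ :=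
  {t | sbaNode x (l - 1) < ((t : ℝ) : EReal) ∧ ((t : ℝ) : EReal) ≤ sbaNode x l}

theorem measurable_sbaNode {Θ : Set ℝ} {j : ℕ} (l : ℕ) :
    Measurable (fun x : SBARow Θ j => sbaNode x l) := by
  unfold sbaNode
  split_ifs with h h0
  · exact measurable_coe_real_ereal.comp (measurable_subtype_coe.comp (measurable_pi_apply _))
  · exact measurable_const
  · exact measurable_const

theorem measurableSet_sbaCell_prod {Θ : Set ℝ} {j : ℕ} (l : ℕ) :
    MeasurableSet {p : SBARow Θ j × Θ | p.2 ∈ sbaCell p.1 l} := by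
  have ht : Measurable (fun p : SBARow Θ j × Θ => (((p.2 : Θ) : ℝ) : EReal)) :=
    measurable_coe_real_ereal.comp (measurable_subtype_coe.comp measurable_snd)
  exact (measurableSet_lt ((measurable_sbaNode (l - 1)).comp measurable_fst) ht).inter
    (measurableSet_le ht ((measurable_sbaNode l).comp measurable_fst))

theorem measurableSet_sbaCell {Θ : Set ℝ} {j : ℕ} (x : SBARow Θ j) (l : ℕ) :
    MeasurableSet (sbaCell x l) :=
  measurable_prodMk_left (x := x) (measurableSet_sbaCell_prod l)

/-- Given the row `x` of level `j`, the entries `μ_{j+1,2l-1}`, `l = 1, …, 2^j`, are drawn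
independently, the `l`-th one from the base measure `H (2l-1)` restricted to (that is, conditioned
on) the interval `(μ_{j,l-1}, μ_{j,l}]`. -/
def sbaKernel {Θ : Set ℝ} (H : ℕ → ProbabilityMeasure Θ) (j : ℕ) :
    Kernel (SBARow Θ j) (Finset.Icc 1 (2 ^ (j + 1 - 1)) → Θ) where
  toFun x := Measure.pi fun l => (H (2 * (l : ℕ) - 1) : Measure Θ)[|sbaCell x l]
  measurable' := by
    refine Measurable.measure_of_isPiSystem generateFrom_pi.symm isPiSystem_pi ?_ ?_
    · rintro _ ⟨s, hs, rfl⟩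
      simp only [Measure.pi_pi]
      refine Finset.measurable_prod _ fun l _ => ?_
      have hsl : MeasurableSet (s l) := hs l (Set.mem_univ l)
      simp_rw [cond_apply (measurableSet_sbaCell _ _)]
      refine Measurable.mul (Measurable.inv ?_) ?_
      · exact measurable_measure_prodMk_left (measurableSet_sbaCell_prod l)
      · exact measurable_measure_prodMk_left
          ((measurableSet_sbaCell_prod l).inter (measurable_snd hsl))
    · simp only [Measure.pi_univ]
      refine Finset.measurable_prod _ fun l _ => ?_
      simp_rw [cond_apply (measurableSet_sbaCell _ _), Set.inter_univ]
      exact (measurable_measure_prodMk_left (measurableSet_sbaCell_prod l)).inv.mul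
        (measurable_measure_prodMk_left (measurableSet_sbaCell_prod l))

/-- The quotient `x / y` with the convention `0 / 0 = 1`. -/
def sbaRatio (x y : ℝ) : ℝ := if x = 0 ∧ y = 0 then 1 else x / y

/-- The inversion formula: `sbaCDF a j l` is the value `G(μ_{j,l})`, `0 ≤ l ≤ 2^j`, of the
distribution function computed from an array `a = (μ_{j,l})`. For `j ≥ 1`,
`G(μ_{j,0}) = 0`, `G(μ_{j,2^j}) = 1`, `G(μ_{j,2l}) = G(μ_{j-1,l})` and
`G(μ_{j,2l-1}) = G(μ_{j-1,l-1}) + [G(μ_{j-1,l}) - G(μ_{j-1,l-1})] *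
  (μ_{j+1,4l-1} - μ_{j+1,4l-2}) / (μ_{j+1,4l-1} - μ_{j+1,4l-3})`.
The recursion is started at level `0`, where the only nodes are `μ_{0,0} = inf Θ` and
`μ_{0,1} = sup Θ`; at level `1` it reads
`G(μ_{1,1}) = (μ_{2,3} - μ_{2,2}) / (μ_{2,3} - μ_{2,1})`. -/
def sbaCDF (a : ℕ → ℕ → ℝ) : ℕ → ℕ → ℝ
  | 0, k => if k = 0 then 0 else 1
  | j + 1, k =>
    if Even k then sbaCDF a j (k / 2)
    else
      let l := (k + 1) / 2
      sbaCDF a j (l - 1) + (sbaCDF a j l - sbaCDF a j (l - 1)) *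
        sbaRatio (a (j + 2) (4 * l - 1) - a (j + 2) (4 * l - 2))
          (a (j + 2) (4 * l - 1) - a (j + 2) (4 * l - 3))

/-- The weight `w_{n,l} = G(Θ_{n,l}) = G(μ_{n,l}) - G(μ_{n,l-1})`, `1 ≤ l ≤ 2^n`. -/
def sbaWeight (a : ℕ → ℕ → ℝ) (n l : ℕ) : ℝ := sbaCDF a n l - sbaCDF a n (l - 1)

/-- Under the probability measure `Pr`, the random measure `G` on `Θ × [0,∞)` is the parsimonious
discrete SBA location-scale measure built from the random array `(μ_{j,l})`,
`1 ≤ j ≤ n + 1`, `1 ≤ l ≤ 2^j - 1`, and the random scales `φ_1, …, φ_{2^n}`. Values of `μ` and `φ`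
at other indices are irrelevant. Here `H j k`, for odd `k ≤ 2^j - 1`, is the base measure
`H_{j,k}`. -/
structure IsDSBASpOf {Θ : Set ℝ} {Ω : Type*} [MeasurableSpace Ω] (Pr : Measure Ω) (n : ℕ)
    (H : ℕ → ℕ → ProbabilityMeasure Θ) (P : ProbabilityMeasure ℝ≥0)
    (G : Ω → ProbabilityMeasure (Θ × ℝ≥0)) (μ : ℕ → ℕ → Ω → Θ) (φ : ℕ → Ω → ℝ≥0) : Prop where
  /-- `μ_{1,1} ∼ H_{1,1}` -/
  root : HasLaw (μ 1 1) (H 1 1 : Measure Θ) Pr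
  /-- `μ_{j,2l} = μ_{j-1,l}` for `2 ≤ j ≤ n + 1` and `1 ≤ l ≤ 2^(j-1) - 1` -/
  inherit : ∀ j ∈ Finset.Icc 2 (n + 1), ∀ l ∈ Finset.Icc 1 (2 ^ (j - 1) - 1),
    ∀ᵐ ω ∂Pr, μ j (2 * l) ω = μ (j - 1) l ω
  /-- for `1 ≤ j ≤ n`, given the rows up to level `j` (which are read off from the row of level
  `j`), the entries `μ_{j+1,2l-1}`, `1 ≤ l ≤ 2^j`, are independent, with laws `H_{j+1,2l-1}`
  restricted to `(μ_{j,l-1}, μ_{j,l}]` -/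
  split : ∀ j ∈ Finset.Icc 1 n,
    HasCondDistrib (sbaNewEntries μ (j + 1)) (sbaRow μ j) (sbaKernel (H (j + 1)) j) Pr
  /-- `φ_1, …, φ_{2^n}` are independent with law `P` … -/
  scale : HasLaw (fun ω (l : Finset.Icc 1 (2 ^ n)) => φ l ω)
    (Measure.pi fun _ => (P : Measure ℝ≥0)) Pr
  /-- … and independent of the array -/
  indep : IndepFun (sbaRow μ (n + 1)) (fun ω (l : Finset.Icc 1 (2 ^ n)) => φ l ω) Pr
  /-- `G = ∑_{l=1}^{2^n} w_{n,l} δ_{(μ_{n+1,2l-1}, φ_l)}` almost surely -/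
  eq_sum : ∀ᵐ ω ∂Pr, (G ω : Measure (Θ × ℝ≥0)) =
    ∑ l ∈ Finset.Icc 1 (2 ^ n),
      ENNReal.ofReal (sbaWeight (fun j k => (μ j k ω : ℝ)) n l) •
        Measure.dirac (μ (n + 1) (2 * l - 1) ω, φ l ω)

/-- `G ∼ DSBASp(n, H, P)` under `Pr`. -/
def IsDSBASp {Θ : Set ℝ} {Ω : Type*} [MeasurableSpace Ω] (Pr : Measure Ω) (n : ℕ)
    (H : ℕ → ℕ → ProbabilityMeasure Θ) (P : ProbabilityMeasure ℝ≥0)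
    (G : Ω → ProbabilityMeasure (Θ × ℝ≥0)) : Prop :=
  ∃ (μ : ℕ → ℕ → Ω → Θ) (φ : ℕ → Ω → ℝ≥0), IsDSBASpOf Pr n H P G μ φ

end

/-! Finitely atomic measures are weakly dense, so it is enough to charge every neighbourhood of an
atomic `g₀` with atoms in `s`. Conditioning on `N = s.card + 1`, an event of positive probability,
leaves a depth `n` with `s.card ≤ n + 1`.

The locations of the atoms are moved slightly so as to be distinct and interior to `Θ`. The
resulting measure on the line is cut at its barycenter again and again
(`exists_dyadicallySeparated`). An atom sitting on the barycenter is halved and its halves are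
pushed apart symmetrically. A cut of several atoms leaves fewer on each side, so `n` cuts reach
single atoms; a lone atom goes on being halved. This gives `2 ^ n` atoms such that the barycenter of
each dyadic block lies strictly between its two halves.

The barycenters of these blocks form a strictly increasing array. The inversion formula is
continuous there and returns the masses of the atoms (`tendsto_sbaCDF`). By full support of the base
measures, the random array is close to this one with positive probability (`measure_sbaRow_pos`).
The scales are independent of it and have full support, so with positive probability they are close
to the prescribed ones as well. Then `G` is weakly close to `g₀`
(`exists_pos_forall_atomic_mem_nhds`). -/

/-! ### Dyadic splitting of atomic measures at barycenters. -/

/-- The barycenter of the masses `w i` placed at the points `t i`, `a ≤ i < a + k`. -/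
noncomputable def blockMean (t w : ℕ → ℝ) (a k : ℕ) : ℝ :=
  (∑ i ∈ Finset.range k, w (a + i) * t (a + i)) / ∑ i ∈ Finset.range k, w (a + i)

/-- The barycenter of each dyadic block of `{0, …, 2^n - 1}` strictly separates the points of its
two halves. -/
def DyadicallySeparated (n : ℕ) (t w : ℕ → ℝ) : Prop :=
  ∀ e l, (l + 1) * 2 ^ (e + 1) ≤ 2 ^ n → ∀ i < 2 ^ e,
    t (l * 2 ^ (e + 1) + i) < blockMean t w (l * 2 ^ (e + 1)) (2 ^ (e + 1)) ∧
    blockMean t w (l * 2 ^ (e + 1)) (2 ^ (e + 1)) < t (l * 2 ^ (e + 1) + 2 ^ e + i)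

theorem blockMean_congr {t w t' w' : ℕ → ℝ} {a b k : ℕ}
    (h : ∀ i < k, t (a + i) = t' (b + i) ∧ w (a + i) = w' (b + i)) :
    blockMean t w a k = blockMean t' w' b k := by
  unfold blockMean
  congr 1 <;> refine Finset.sum_congr rfl fun i hi => ?_
  · rw [(h i (Finset.mem_range.1 hi)).1, (h i (Finset.mem_range.1 hi)).2]
  · rw [(h i (Finset.mem_range.1 hi)).2]

/-- The sequence whose first `N` terms are those of `f`, followed by the terms of `g`. -/
def seqAppend {α : Type*} (N : ℕ) (f g : ℕ → α) (i : ℕ) : α := if i < N then f i else g (i - N)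

theorem seqAppend_left {α : Type*} {N : ℕ} (f g : ℕ → α) {i : ℕ} (h : i < N) :
    seqAppend N f g i = f i := if_pos h

theorem seqAppend_right {α : Type*} (N : ℕ) (f g : ℕ → α) (i : ℕ) :
    seqAppend N f g (N + i) = g i := by
  simp [seqAppend]

/-- A dyadic block of the concatenation is either the whole of it, where `m` separates, or a block
of one of the two pieces. -/
theorem DyadicallySeparated.append {n : ℕ} {t t' w w' : ℕ → ℝ} (h : DyadicallySeparated n t w)
    (h' : DyadicallySeparated n t' w') {m : ℝ}
    (hm : blockMean (seqAppend (2 ^ n) t t') (seqAppend (2 ^ n) w w') 0 (2 ^ (n + 1)) = m)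
    (ht : ∀ i < 2 ^ n, t i < m) (ht' : ∀ i < 2 ^ n, m < t' i) :
    DyadicallySeparated (n + 1) (seqAppend (2 ^ n) t t') (seqAppend (2 ^ n) w w') := by
  intro e l hl i hi
  have hle : e ≤ n := by
    have : 2 ^ (e + 1) ≤ 2 ^ (n + 1) := le_trans (Nat.le_mul_of_pos_left _ (by omega)) hl
    have := (Nat.pow_le_pow_iff_right (by norm_num : 1 < 2)).1 this
    omega
  rcases hle.eq_or_lt with rfl | hlt
  · obtain rfl : l = 0 := by
      have : l + 1 ≤ 1 :=
        Nat.le_of_mul_le_mul_right (hl.trans_eq (one_mul _).symm) (Nat.two_pow_pos (e + 1))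
      omega
    simp only [zero_mul, zero_add, hm]
    rw [seqAppend_left _ _ hi, seqAppend_right]
    exact ⟨ht i hi, ht' i hi⟩
  · obtain ⟨d, rfl⟩ : ∃ d, n = d + (e + 1) := ⟨n - (e + 1), by omega⟩
    have hpe : 2 ^ (e + 1) = 2 ^ e + 2 ^ e := by ring
    rcases lt_or_ge l (2 ^ d) with hld | hld
    · have hb : (l + 1) * 2 ^ (e + 1) ≤ 2 ^ (d + (e + 1)) := by
        rw [pow_add 2 d]; exact Nat.mul_le_mul_right _ hld
      have hb' : l * 2 ^ (e + 1) + 2 ^ (e + 1) ≤ 2 ^ (d + (e + 1)) := by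
        rwa [Nat.succ_mul] at hb
      rw [blockMean_congr (t' := t) (w' := w) (b := l * 2 ^ (e + 1)), seqAppend_left _ _ (by omega),
        seqAppend_left _ _ (by omega)]
      · exact h e l hb i hi
      · intro k hk
        exact ⟨seqAppend_left _ _ (by omega), seqAppend_left _ _ (by omega)⟩
    · obtain ⟨l, rfl⟩ := Nat.exists_eq_add_of_le hld
      have hb : (l + 1) * 2 ^ (e + 1) ≤ 2 ^ (d + (e + 1)) := by
        have : 2 ^ (d + (e + 1) + 1) = 2 ^ (d + (e + 1)) + 2 ^ d * 2 ^ (e + 1) := by ring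
        rw [this] at hl
        have : (2 ^ d + l + 1) * 2 ^ (e + 1) = (l + 1) * 2 ^ (e + 1) + 2 ^ d * 2 ^ (e + 1) := by ring
        omega
      have hs : (2 ^ d + l) * 2 ^ (e + 1) = 2 ^ (d + (e + 1)) + l * 2 ^ (e + 1) := by ring
      rw [hs, blockMean_congr (t' := t') (w' := w') (b := l * 2 ^ (e + 1)), add_assoc, add_assoc,
        add_assoc, seqAppend_right, seqAppend_right, ← add_assoc]
      · exact h' e l hb i hi
      · intro k _
        rw [add_assoc, seqAppend_right, seqAppend_right]
        exact ⟨rfl, rfl⟩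

/-- The type `α` is free so that the formula serves both labels of atoms and, with `f` the identity,
their positions. -/
theorem sum_range_seqAppend {n : ℕ} {w w' : ℕ → ℝ} {α : Type*} {ρ ρ' : ℕ → α} (f : α → ℝ) :
    ∑ i ∈ Finset.range (2 ^ (n + 1)),
      seqAppend (2 ^ n) w w' i * f (seqAppend (2 ^ n) ρ ρ' i) =
    (∑ i ∈ Finset.range (2 ^ n), w i * f (ρ i)) + ∑ i ∈ Finset.range (2 ^ n), w' i * f (ρ' i) := by
  rw [pow_succ, mul_two, Finset.sum_range_add]
  congr 1 <;> refine Finset.sum_congr rfl fun i hi => ?_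
  · rw [seqAppend_left _ _ (Finset.mem_range.1 hi), seqAppend_left _ _ (Finset.mem_range.1 hi)]
  · rw [seqAppend_right, seqAppend_right]

/-- Not all atoms lie above their mean. If some atom does, the filter loses it; otherwise all atoms
sit at the mean, and injectivity leaves only one. -/
theorem filter_le_mean {ι : Type*} {s : Finset ι} (hs : s.Nonempty) {p x : ι → ℝ} {m : ℝ}
    {n : ℕ} (hp : ∀ a ∈ s, 0 < p a) (hx : Set.InjOn x s) (hcard : s.card ≤ n + 2)
    (hm : ∑ a ∈ s, p a * (x a - m) = 0) :
    (s.filter fun a => x a ≤ m).Nonempty ∧ (s.filter fun a => x a ≤ m).card ≤ n + 1 := by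
  constructor
  · obtain ⟨a, ha, h⟩ := Finset.exists_le_of_sum_le (f := fun a => p a * (x a - m))
      (g := fun _ => (0 : ℝ)) hs (by simp [hm])
    refine ⟨a, Finset.mem_filter.2 ⟨ha, ?_⟩⟩
    by_contra! hc
    exact absurd h (not_le.2 (mul_pos (hp a ha) (by linarith)))
  · by_cases h : ∃ a ∈ s, m < x a
    · obtain ⟨a, ha, h⟩ := h
      have : (s.filter fun a => x a ≤ m).card < s.card := Finset.card_lt_card
        (Finset.filter_ssubset.2 ⟨a, ha, not_le.2 h⟩)
      omega
    · push Not at h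
      have h0 : ∀ a ∈ s, p a * (x a - m) = 0 := by
        refine (Finset.sum_eq_zero_iff_of_nonpos fun a ha => ?_).1 hm
        exact mul_nonpos_of_nonneg_of_nonpos (hp a ha).le (by linarith [h a ha])
      have : s.card ≤ 1 := Finset.card_le_one.2 fun a ha b hb => hx ha hb (by
        have h1 := (mul_eq_zero.1 (h0 a ha)).resolve_left (hp a ha).ne'
        have h2 := (mul_eq_zero.1 (h0 b hb)).resolve_left (hp b hb).ne'
        linarith)
      exact (Finset.card_filter_le _ _).trans (by omega)

theorem exists_gap {ι : Type*} (s : Finset ι) (x : ι → ℝ) (m : ℝ) :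
    ∃ γ > 0, ∀ a ∈ s, x a ≠ m → γ ≤ |x a - m| := by
  classical
  induction s using Finset.induction_on with
  | empty => exact ⟨1, one_pos, by simp⟩
  | insert b s _ ih =>
    obtain ⟨γ, hγ, h⟩ := ih
    by_cases hb : x b = m
    · refine ⟨γ, hγ, fun a ha hne => ?_⟩
      rcases Finset.mem_insert.1 ha with rfl | ha
      · exact absurd hb hne
      · exact h a ha hne
    · refine ⟨min γ |x b - m|, lt_min hγ (abs_pos.2 (sub_ne_zero.2 hb)), fun a ha hne => ?_⟩
      rcases Finset.mem_insert.1 ha with rfl | ha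
      · exact min_le_right _ _
      · exact (min_le_left _ _).trans (h a ha hne)

/-- An atom at `m` gives half its mass to each side. Three functions are allowed because the two
halves move to `m - δ` and `m + δ`, whose average is still `m`; this preserves the first moment. -/
theorem sum_split_at {ι : Type*} (s : Finset ι) (p x f g h : ι → ℝ) (m : ℝ)
    (hlt : ∀ a ∈ s, x a < m → f a = h a) (hgt : ∀ a ∈ s, m < x a → g a = h a)
    (heq : ∀ a ∈ s, x a = m → f a + g a = 2 * h a) :
    (∑ a ∈ s.filter (fun a => x a ≤ m), (if x a = m then p a / 2 else p a) * f a) +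
      ∑ a ∈ s.filter (fun a => m ≤ x a), (if x a = m then p a / 2 else p a) * g a =
    ∑ a ∈ s, p a * h a := by
  rw [Finset.sum_filter, Finset.sum_filter, ← Finset.sum_add_distrib]
  refine Finset.sum_congr rfl fun a ha => ?_
  rcases lt_trichotomy (x a) m with hlt' | heq' | hgt'
  · simp [hlt'.le, hlt'.ne, not_le.2 hlt', hlt a ha hlt']
  · have := heq a ha heq'
    simp only [heq', le_refl, if_true]
    linear_combination p a / 2 * this
  · simp [hgt'.le, hgt'.ne', not_le.2 hgt', hgt a ha hgt']

/-- A finite atomic measure on the line with at most `n + 1` atoms is approximated by one with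
`2^n` atoms that is dyadically separated, each new atom splitting off from an old one nearby. -/
theorem exists_dyadicallySeparated {ι : Type*} (n : ℕ) :
    ∀ (s : Finset ι) (p x : ι → ℝ) (ε : ℝ), s.Nonempty → s.card ≤ n + 1 → (∀ a ∈ s, 0 < p a) →
      Set.InjOn x s → 0 < ε →
      ∃ (t w : ℕ → ℝ) (ρ : ℕ → ι),
        (∀ i < 2 ^ n, ρ i ∈ s ∧ 0 < w i ∧ |t i - x (ρ i)| < ε) ∧
        (∀ f : ι → ℝ, ∑ i ∈ Finset.range (2 ^ n), w i * f (ρ i) = ∑ a ∈ s, p a * f a) ∧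
        ∑ i ∈ Finset.range (2 ^ n), w i * t i = ∑ a ∈ s, p a * x a ∧
        DyadicallySeparated n t w := by
  induction n with
  | zero =>
    intro s p x ε hs hcard hp hx hε
    obtain ⟨a, rfl⟩ := Finset.card_eq_one.1 (le_antisymm hcard (Finset.card_pos.2 hs))
    refine ⟨fun _ => x a, fun _ => p a, fun _ => a, ?_, ?_, ?_, ?_⟩
    · intro i _
      simp only [Finset.mem_singleton, sub_self, abs_zero, true_and]
      exact ⟨hp a (by simp), hε⟩
    · simp
    · simp
    -- Vacuous: no block of length at least 2 fits into a single point.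
    · intro e l hl
      have : 2 ≤ 2 ^ (e + 1) := by
        rw [pow_succ]; have := Nat.one_le_two_pow (n := e); omega
      have : 2 ^ (e + 1) ≤ (l + 1) * 2 ^ (e + 1) := Nat.le_mul_of_pos_left _ (by omega)
      simp only [pow_zero] at hl
      omega
  | succ n ih =>
    intro s p x ε hs hcard hp hx hε
    set W := ∑ a ∈ s, p a with hW
    set m := (∑ a ∈ s, p a * x a) / W with hm
    have hWpos : 0 < W := Finset.sum_pos hp hs
    have hmW : ∑ a ∈ s, p a * x a = W * m := by rw [hm]; field_simp
    have hm0 : ∑ a ∈ s, p a * (x a - m) = 0 := by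
      simp_rw [mul_sub, Finset.sum_sub_distrib, ← Finset.sum_mul, hmW, ← hW, sub_self]
    obtain ⟨γ, hγ, hgap⟩ := exists_gap s x m
    -- Below the gap `γ`, so that a halved atom meets no other atom. With tolerance `δ / 2` in the
    -- recursion, points stay on their side of `m` and the total displacement is below `ε`.
    set δ := min γ ε / 2 with hδ
    have hδ0 : 0 < δ := half_pos (lt_min hγ hε)
    have hδγ : δ < γ := by have := min_le_left γ ε; have := lt_min hγ hε; rw [hδ]; linarith
    have hδε : δ ≤ ε / 2 := by have := min_le_right γ ε; rw [hδ]; linarith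
    let q : ι → ℝ := fun a => if x a = m then p a / 2 else p a
    let y : ι → ℝ := fun a => if x a = m then m - δ else x a
    let z : ι → ℝ := fun a => if x a = m then m + δ else x a
    have hq : ∀ a ∈ s, 0 < q a := fun a ha => by
      have := hp a ha
      simp only [q]; split_ifs <;> linarith
    have hlow : ∀ a ∈ s, x a ≤ m → x a ≠ m → x a < m - δ := fun a ha h1 h2 => by
      have := hgap a ha h2
      rw [abs_of_nonpos (by linarith)] at this
      linarith
    have hhigh : ∀ a ∈ s, m ≤ x a → x a ≠ m → m + δ < x a := fun a ha h1 h2 => by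
      have := hgap a ha h2
      rw [abs_of_nonneg (by linarith)] at this
      linarith
    have hL := filter_le_mean hs hp hx hcard hm0
    -- The upper half is the lower half of the reflected measure.
    have hR := filter_le_mean (x := fun a => -x a) (m := -m) hs hp
      (fun a ha b hb h => hx ha hb (neg_injective h)) hcard
      (by rw [← neg_eq_zero, ← Finset.sum_neg_distrib, ← hm0]
          exact Finset.sum_congr rfl fun a _ => by ring)
    simp only [neg_le_neg_iff] at hR
    obtain ⟨t, w, ρ, h1, h2, h3, h4⟩ := ih (s.filter fun a => x a ≤ m) q y (δ / 2) hL.1 hL.2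
      (fun a ha => hq a (Finset.mem_filter.1 ha).1)
      (by
        intro a ha b hb hab
        simp only [Finset.coe_filter, Set.mem_ofPred_eq] at ha hb
        refine hx ha.1 hb.1 ?_
        simp only [y] at hab
        split_ifs at hab with c1 c2 c2
        · rw [c1, c2]
        · linarith [hlow b hb.1 hb.2 c2]
        · linarith [hlow a ha.1 ha.2 c1]
        · exact hab) (half_pos hδ0)
    obtain ⟨t', w', ρ', h1', h2', h3', h4'⟩ := ih (s.filter fun a => m ≤ x a) q z (δ / 2) hR.1 hR.2
      (fun a ha => hq a (Finset.mem_filter.1 ha).1)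
      (by
        intro a ha b hb hab
        simp only [Finset.coe_filter, Set.mem_ofPred_eq] at ha hb
        refine hx ha.1 hb.1 ?_
        simp only [z] at hab
        split_ifs at hab with c1 c2 c2
        · rw [c1, c2]
        · linarith [hhigh b hb.1 hb.2 c2]
        · linarith [hhigh a ha.1 ha.2 c1]
        · exact hab) (half_pos hδ0)
    have hf : ∀ f : ι → ℝ, ∑ i ∈ Finset.range (2 ^ (n + 1)),
        seqAppend (2 ^ n) w w' i * f (seqAppend (2 ^ n) ρ ρ' i) = ∑ a ∈ s, p a * f a := fun f => by
      rw [sum_range_seqAppend, h2 f, h2' f]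
      exact sum_split_at s p x f f f m (fun _ _ _ => rfl) (fun _ _ _ => rfl) fun _ _ _ => by ring
    have ht : ∑ i ∈ Finset.range (2 ^ (n + 1)),
        seqAppend (2 ^ n) w w' i * seqAppend (2 ^ n) t t' i = ∑ a ∈ s, p a * x a := by
      have := sum_range_seqAppend (n := n) (w := w) (w' := w') (ρ := t) (ρ' := t') (fun u => u)
      rw [this, h3, h3']
      refine sum_split_at s p x y z x m (fun a _ h => ?_) (fun a _ h => ?_) fun a _ h => ?_
      · simp [y, h.ne]
      · simp [z, h.ne']
      · simp only [y, z, h, if_true]; ring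
    refine ⟨seqAppend (2 ^ n) t t', seqAppend (2 ^ n) w w', seqAppend (2 ^ n) ρ ρ', ?_, hf, ht, ?_⟩
    · intro i hi
      rcases lt_or_ge i (2 ^ n) with hin | hin
      · simp only [seqAppend_left _ _ hin]
        obtain ⟨ha, hb, hc⟩ := h1 i hin
        refine ⟨(Finset.mem_filter.1 ha).1, hb, ?_⟩
        have : |y (ρ i) - x (ρ i)| ≤ δ := by
          simp only [y]; split_ifs with c
          · rw [c, abs_le]; constructor <;> linarith
          · simpa using hδ0.le
        have := abs_sub_le (t i) (y (ρ i)) (x (ρ i))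
        linarith
      · obtain ⟨i, rfl⟩ := Nat.exists_eq_add_of_le hin
        simp only [seqAppend_right]
        obtain ⟨ha, hb, hc⟩ := h1' i (by rw [pow_succ] at hi; omega)
        refine ⟨(Finset.mem_filter.1 ha).1, hb, ?_⟩
        have : |z (ρ' i) - x (ρ' i)| ≤ δ := by
          simp only [z]; split_ifs with c
          · rw [c, abs_le]; constructor <;> linarith
          · simpa using hδ0.le
        have := abs_sub_le (t' i) (z (ρ' i)) (x (ρ' i))
        linarith
    · refine h4.append h4' (m := m) ?_ (fun i hi => ?_) fun i hi => ?_
      · have hw := hf fun _ => 1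
        simp only [mul_one] at hw
        simp only [blockMean, zero_add, ht, hw, hm, hW]
      · obtain ⟨ha, -, hc⟩ := h1 i hi
        have ha' := Finset.mem_filter.1 ha
        have : y (ρ i) ≤ m - δ := by
          simp only [y]; split_ifs with c
          · exact le_rfl
          · exact (hlow _ ha'.1 ha'.2 c).le
        linarith [(abs_lt.1 hc).2]
      · obtain ⟨ha, -, hc⟩ := h1' i hi
        have ha' := Finset.mem_filter.1 ha
        have : m + δ ≤ z (ρ' i) := by
          simp only [z]; split_ifs with c
          · exact le_rfl
          · exact (hhigh _ ha'.1 ha'.2 c).le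
        linarith [(abs_lt.1 hc).1]

/-! ### The inversion formula near an array of barycenters. -/

open Filter Topology in
theorem tendsto_sbaRatio {β : Type*} {F : Filter β} {f g : β → ℝ} {x y : ℝ}
    (hf : Tendsto f F (𝓝 x)) (hg : Tendsto g F (𝓝 y)) (hy : y ≠ 0) :
    Tendsto (fun b => sbaRatio (f b) (g b)) F (𝓝 (x / y)) := by
  refine (hf.div hg hy).congr' ?_
  filter_upwards [hg.eventually_ne hy] with b hb
  simp [sbaRatio, hb]

theorem sbaCDF_congr {a b : ℕ → ℕ → ℝ} {n : ℕ}
    (h : ∀ j ∈ Finset.Icc 1 (n + 1), ∀ k ∈ Finset.Icc 1 (2 ^ j - 1), a j k = b j k) :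
    ∀ j ≤ n, ∀ k ≤ 2 ^ j, sbaCDF a j k = sbaCDF b j k := by
  intro j
  induction j with
  | zero => intros; rfl
  | succ j ih =>
    intro hj k hk
    have hp : 2 ^ (j + 1) = 2 * 2 ^ j := by ring
    have hp' : 2 ^ (j + 2) = 4 * 2 ^ j := by ring
    simp only [sbaCDF]
    split_ifs with he
    · exact ih (by omega) _ (by omega)
    · obtain ⟨q, rfl⟩ := Nat.not_even_iff_odd.1 he
      rw [ih (by omega) _ (by omega), ih (by omega) _ (by omega)]
      simp only [Finset.mem_Icc] at h
      rw [h (j + 2) (by omega) _ (by omega), h (j + 2) (by omega) _ (by omega),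
        h (j + 2) (by omega) _ (by omega)]

/-- The in-order listing of the barycenters of the dyadic blocks: the index `2^e * (2 * l + 1)`
carries the barycenter of the `l`-th block of length `2^e`. -/
noncomputable def dyadicMean (t w : ℕ → ℝ) (k : ℕ) : ℝ :=
  blockMean t w (k / 2 ^ (padicValNat 2 k + 1) * 2 ^ padicValNat 2 k) (2 ^ padicValNat 2 k)

theorem dyadicMean_eq (t w : ℕ → ℝ) (e l : ℕ) :
    dyadicMean t w ((2 * l + 1) * 2 ^ e) = blockMean t w (l * 2 ^ e) (2 ^ e) := by
  have hv : padicValNat 2 ((2 * l + 1) * 2 ^ e) = e := by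
    rw [padicValNat.mul (by omega) (by positivity), padicValNat.prime_pow,
      padicValNat.eq_zero_of_not_dvd (by omega), zero_add]
  have hd : (2 * l + 1) * 2 ^ e / 2 ^ (e + 1) = l := by
    rw [pow_succ', Nat.mul_div_mul_right _ _ (by positivity)]
    omega
  rw [dyadicMean, hv, hd]

theorem dyadicMean_odd {t w : ℕ → ℝ} {l : ℕ} (h : w l ≠ 0) :
    dyadicMean t w (2 * l + 1) = t l := by
  have := dyadicMean_eq t w 0 l
  simp only [pow_zero, mul_one] at this
  rw [this]
  simp [blockMean, h]

theorem exists_eq_odd_mul_two_pow {k : ℕ} (hk : k ≠ 0) : ∃ e l, k = (2 * l + 1) * 2 ^ e := by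
  obtain ⟨e, m, hm, rfl⟩ := Nat.exists_eq_two_pow_mul_odd hk
  obtain ⟨l, rfl⟩ := hm
  exact ⟨e, l, mul_comm _ _⟩

/-- After division by `2 ^ e`, an odd number lies below an even one, so its successor does not
exceed it. Hence the block cut at this index fits inside the whole. -/
theorem succ_mul_two_pow_le {e l n : ℕ} (h : (2 * l + 1) * 2 ^ e < 2 ^ n) :
    (l + 1) * 2 ^ (e + 1) ≤ 2 ^ n := by
  have he : 2 ^ e < 2 ^ n := lt_of_le_of_lt (Nat.le_mul_of_pos_left _ (by omega)) h
  have := (Nat.pow_lt_pow_iff_right (by norm_num : 1 < 2)).1 he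
  obtain ⟨d, rfl⟩ : ∃ d, n = d + 1 + e := ⟨n - e - 1, by omega⟩
  rw [pow_add] at h
  have h1 := lt_of_mul_lt_mul_right h (Nat.zero_le _)
  rw [pow_succ] at h1
  have : (l + 1) * 2 ^ (e + 1) ≤ 2 ^ d * 2 ^ (e + 1) := Nat.mul_le_mul_right _ (by omega)
  refine this.trans_eq (by ring)

namespace DyadicallySeparated

variable {n : ℕ} {t w : ℕ → ℝ}

/-- Of two consecutive indices the odd one carries an atom and the even one the barycenter of a
block. The atom is the first of the right half or the last of the left half of that block. -/
theorem dyadicMean_lt_succ (h : DyadicallySeparated n t w) (hw : ∀ i < 2 ^ n, 0 < w i) {k : ℕ}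
    (hk : 1 ≤ k) (hkn : k + 1 < 2 ^ (n + 1)) : dyadicMean t w k < dyadicMean t w (k + 1) := by
  have hp : 2 ^ (n + 1) = 2 * 2 ^ n := by ring
  rcases Nat.even_or_odd k with he | ⟨i, rfl⟩
  · obtain ⟨q, rfl⟩ := he
    obtain ⟨e, l, rfl⟩ := exists_eq_odd_mul_two_pow (k := q) (by omega)
    have h1 := (h e l (succ_mul_two_pow_le (by omega)) 0 (by positivity)).2
    have h2 : (2 * l + 1) * 2 ^ e = l * 2 ^ (e + 1) + 2 ^ e + 0 := by ring
    rw [← two_mul ((2 * l + 1) * 2 ^ e), dyadicMean_odd (hw _ (by omega)).ne',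
      show 2 * ((2 * l + 1) * 2 ^ e) = (2 * l + 1) * 2 ^ (e + 1) by ring, dyadicMean_eq, h2]
    exact h1
  · obtain ⟨e, l, hq⟩ := exists_eq_odd_mul_two_pow (k := i + 1) (by omega)
    have he := Nat.two_pow_pos e
    have h1 := (h e l (succ_mul_two_pow_le (by omega)) (2 ^ e - 1) (by omega)).1
    have h2 : (2 * l + 1) * 2 ^ e = l * 2 ^ (e + 1) + 2 ^ e := by ring
    rw [dyadicMean_odd (hw _ (by omega)).ne',
      show 2 * i + 1 + 1 = (2 * l + 1) * 2 ^ (e + 1) by rw [pow_succ]; linarith, dyadicMean_eq,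
      show i = l * 2 ^ (e + 1) + (2 ^ e - 1) by omega]
    exact h1

theorem dyadicMean_lt (h : DyadicallySeparated n t w) (hw : ∀ i < 2 ^ n, 0 < w i) {k k' : ℕ}
    (hk : 1 ≤ k) (hkk' : k < k') (hkn : k' < 2 ^ (n + 1)) :
    dyadicMean t w k < dyadicMean t w k' := by
  induction k', hkk' using Nat.le_induction with
  | base => exact h.dyadicMean_lt_succ hw hk hkn
  | succ m hm ih =>
    exact (ih (by omega)).trans
      (h.dyadicMean_lt_succ hw (hk.trans (Nat.le_of_succ_le hm)) hkn)

open Filter Topology in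
/-- Near the array of barycenters of the dyadic blocks, the inversion formula returns nearly the
cumulative masses. -/
theorem tendsto_sbaCDF (h : DyadicallySeparated n t w) (hw : ∀ i < 2 ^ n, 0 < w i)
    (hsum : ∑ i ∈ Finset.range (2 ^ n), w i = 1) {β : Type*} {F : Filter β} {a : β → ℕ → ℕ → ℝ}
    (ha : ∀ j ∈ Finset.Icc 1 (n + 1), ∀ k ∈ Finset.Icc 1 (2 ^ j - 1),
      Tendsto (fun b => a b j k) F (𝓝 (dyadicMean t w (k * 2 ^ (n + 1 - j))))) :
    ∀ j ≤ n, ∀ k ≤ 2 ^ j, Tendsto (fun b => sbaCDF (a b) j k) F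
      (𝓝 (∑ i ∈ Finset.range (k * 2 ^ (n - j)), w i)) := by
  intro j
  induction j with
  | zero =>
    intro _ k hk
    simp only [pow_zero] at hk
    interval_cases k
    · simpa [sbaCDF] using tendsto_const_nhds
    · simpa [sbaCDF, hsum] using tendsto_const_nhds
  | succ j ih =>
    intro hj k hk
    obtain ⟨E, rfl⟩ : ∃ E, n = E + (j + 1) := ⟨n - (j + 1), by omega⟩
    have hp : 2 ^ (j + 1) = 2 * 2 ^ j := by ring
    have hp' : 2 ^ (j + 2) = 4 * 2 ^ j := by ring
    have e1 : E + (j + 1) - (j + 1) = E := by omega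
    have e2 : E + (j + 1) - j = E + 1 := by omega
    have e3 : E + (j + 1) + 1 - (j + 2) = E := by omega
    simp only [e1, e2] at ih ⊢
    rcases Nat.even_or_odd k with he | ⟨q, rfl⟩
    · have hk2 : k / 2 * 2 ^ (E + 1) = k * 2 ^ E := by
        obtain ⟨q, rfl⟩ := he
        rw [← two_mul, Nat.mul_div_cancel_left _ (by norm_num)]; ring
      simp only [sbaCDF, he, if_true]
      rw [← hk2]
      exact ih (by omega) _ (by omega)
    · have ho : ¬ Even (2 * q + 1) := Nat.not_even_iff_odd.2 ⟨q, rfl⟩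
      simp only [sbaCDF, ho, if_false, show (2 * q + 1 + 1) / 2 = q + 1 by omega,
        Nat.add_sub_cancel, show 4 * (q + 1) - 1 = 4 * q + 3 by omega,
        show 4 * (q + 1) - 2 = 4 * q + 2 by omega, show 4 * (q + 1) - 3 = 4 * q + 1 by omega]
      simp only [Finset.mem_Icc] at ha
      have a1 := ha (j + 2) (by omega) (4 * q + 1) (by omega)
      have a2 := ha (j + 2) (by omega) (4 * q + 2) (by omega)
      have a3 := ha (j + 2) (by omega) (4 * q + 3) (by omega)
      rw [e3] at a1 a2 a3
      -- The limiting denominator is nonzero, so the convention for `0 / 0` plays no role nearby.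
      have hlt : dyadicMean t w ((4 * q + 1) * 2 ^ E) < dyadicMean t w ((4 * q + 3) * 2 ^ E) := by
        refine h.dyadicMean_lt hw (Nat.one_le_iff_ne_zero.2 (by positivity))
          (Nat.mul_lt_mul_of_pos_right (by omega) (by positivity)) ?_
        calc (4 * q + 3) * 2 ^ E < 2 ^ (j + 2) * 2 ^ E :=
              Nat.mul_lt_mul_of_pos_right (by omega) (by positivity)
          _ = 2 ^ (E + (j + 1) + 1) := by ring
      have hlim := ((ih (by omega) q (by omega))).add (((ih (by omega) (q + 1) (by omega)).sub
        (ih (by omega) q (by omega))).mul (tendsto_sbaRatio (a3.sub a2) (a3.sub a1)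
          (sub_pos.2 hlt).ne'))
      convert hlim using 2
      have b1 : (4 * q + 1) * 2 ^ E = (2 * (2 * q) + 1) * 2 ^ E := by ring
      have b2 : (4 * q + 2) * 2 ^ E = (2 * q + 1) * 2 ^ (E + 1) := by ring
      have b3 : (4 * q + 3) * 2 ^ E = (2 * (2 * q + 1) + 1) * 2 ^ E := by ring
      have c1 : 2 * q * 2 ^ E = q * 2 ^ (E + 1) := by ring
      have c3 : (2 * q + 1) * 2 ^ E = q * 2 ^ (E + 1) + 2 ^ E := by ring
      have c4 : (q + 1) * 2 ^ (E + 1) = q * 2 ^ (E + 1) + 2 ^ E + 2 ^ E := by ring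
      have c5 : 2 ^ (E + 1) = 2 ^ E + 2 ^ E := by ring
      have hle : (q + 1) * 2 ^ (E + 1) ≤ 2 ^ (E + (j + 1)) := by
        calc (q + 1) * 2 ^ (E + 1) ≤ 2 ^ j * 2 ^ (E + 1) := Nat.mul_le_mul_right _ (by omega)
          _ = _ := by ring
      rw [b1, b3, dyadicMean_eq, dyadicMean_eq, c1, c3] at hlt
      rw [b1, b2, b3, dyadicMean_eq, dyadicMean_eq, dyadicMean_eq, c1, c3, c4]
      simp only [blockMean, Finset.sum_range_add, c5] at hlt ⊢
      rw [c4, c5] at hle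
      generalize q * (2 ^ E + 2 ^ E) = A at *
      have hpos : 0 < 2 ^ E := by positivity
      have hW1 : 0 < ∑ i ∈ Finset.range (2 ^ E), w (A + i) :=
        Finset.sum_pos (fun i hi => hw _ (by have := Finset.mem_range.1 hi; omega))
          ⟨0, Finset.mem_range.2 hpos⟩
      have hW2 : 0 < ∑ i ∈ Finset.range (2 ^ E), w (A + 2 ^ E + i) :=
        Finset.sum_pos (fun i hi => hw _ (by have := Finset.mem_range.1 hi; omega))
          ⟨0, Finset.mem_range.2 hpos⟩
      simp only [add_assoc] at hW2 hlt ⊢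
      generalize ∑ i ∈ Finset.range (2 ^ E), w (A + i) = W1 at *
      generalize ∑ i ∈ Finset.range (2 ^ E), w (A + (2 ^ E + i)) = W2 at *
      generalize ∑ i ∈ Finset.range (2 ^ E), w (A + i) * t (A + i) = S1 at *
      generalize ∑ i ∈ Finset.range (2 ^ E), w (A + (2 ^ E + i)) * t (A + (2 ^ E + i)) = S2 at *
      have hd : S2 / W2 - S1 / W1 ≠ 0 := (sub_pos.2 hlt).ne'
      have hW : W1 + W2 ≠ 0 := by positivity
      -- Lever rule: the barycenter of a block divides the segment between those of its halves
      -- inversely to their masses.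
      have key : (S2 / W2 - (S1 + S2) / (W1 + W2)) / (S2 / W2 - S1 / W1) = W1 / (W1 + W2) := by
        rw [div_eq_div_iff hd hW]
        field_simp
        ring
      rw [key]
      field_simp
      ring

open Filter Topology in
theorem tendsto_sbaWeight (h : DyadicallySeparated n t w) (hw : ∀ i < 2 ^ n, 0 < w i)
    (hsum : ∑ i ∈ Finset.range (2 ^ n), w i = 1) {β : Type*} {F : Filter β} {a : β → ℕ → ℕ → ℝ}
    (ha : ∀ j ∈ Finset.Icc 1 (n + 1), ∀ k ∈ Finset.Icc 1 (2 ^ j - 1),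
      Tendsto (fun b => a b j k) F (𝓝 (dyadicMean t w (k * 2 ^ (n + 1 - j)))))
    {l : ℕ} (hl : l ∈ Finset.Icc 1 (2 ^ n)) :
    Tendsto (fun b => sbaWeight (a b) n l) F (𝓝 (w (l - 1))) := by
  obtain ⟨hl1, hl2⟩ := Finset.mem_Icc.1 hl
  obtain ⟨l, rfl⟩ := Nat.exists_eq_add_of_le' hl1
  have := (h.tendsto_sbaCDF hw hsum ha n le_rfl (l + 1) hl2).sub
    (h.tendsto_sbaCDF hw hsum ha n le_rfl l (by omega))
  simpa [Finset.sum_range_succ, sbaWeight] using this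

end DyadicallySeparated

/-! ### Atomic measures in the weak topology. -/

section WeakTopology

open Filter Topology BoundedContinuousFunction

variable {X : Type*} [MetricSpace X] [MeasurableSpace X] [BorelSpace X]
  [SecondCountableTopology X]

theorem integral_finset_sum_dirac {ι : Type*} (J : Finset ι) {w : ι → ℝ} (z : ι → X)
    (hw : ∀ l ∈ J, 0 ≤ w l) (f : X →ᵇ ℝ) :
    ∫ x, f x ∂(∑ l ∈ J, ENNReal.ofReal (w l) • Measure.dirac (z l)) = ∑ l ∈ J, w l * f (z l) := by
  rw [integral_finsetSum_measure]
  · refine Finset.sum_congr rfl fun l hl => ?_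
    rw [integral_smul_measure, integral_dirac, ENNReal.toReal_ofReal (hw l hl), smul_eq_mul]
  · intro l _
    have : IsFiniteMeasure (ENNReal.ofReal (w l) • Measure.dirac (z l)) :=
      Measure.smul_finite _ ENNReal.ofReal_ne_top
    exact f.integrable _

open Classical in
/-- A weak neighbourhood of a finite atomic probability measure contains all atomic probability
measures obtained by moving and splitting its atoms, and changing their masses, only slightly. -/
theorem exists_pos_forall_atomic_mem_nhds {ι : Type*} (J : Finset ι) {g₀ : ProbabilityMeasure X}
    {s : Finset X} {p : X → ℝ}
    (hg₀ : ∀ f : X →ᵇ ℝ, ∫ x, f x ∂(g₀ : Measure X) = ∑ a ∈ s, p a * f a)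
    {U : Set (ProbabilityMeasure X)} (hU : U ∈ 𝓝 g₀) :
    ∃ ε > 0, ∀ (g : ProbabilityMeasure X) (w : ι → ℝ) (z ρ : ι → X),
      (∀ l ∈ J, 0 ≤ w l ∧ ρ l ∈ s ∧ dist (z l) (ρ l) < ε) →
      (∀ a ∈ s, dist (∑ l ∈ J with ρ l = a, w l) (p a) < ε) →
      (g : Measure X) = ∑ l ∈ J, ENNReal.ofReal (w l) • Measure.dirac (z l) → g ∈ U := by
  by_contra! hcon
  choose g w z ρ h1 h2 h3 h4 using fun k : ℕ => hcon (1 / ((k : ℝ) + 1)) Nat.one_div_pos_of_nat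
  have hε : Tendsto (fun k : ℕ => 1 / ((k : ℝ) + 1)) atTop (𝓝 0) :=
    tendsto_one_div_add_atTop_nhds_zero_nat
  suffices hg : Tendsto g atTop (𝓝 g₀) by
    obtain ⟨k, hk⟩ := (hg.eventually hU).exists
    exact h4 k hk
  have hmass : ∀ a ∈ s, Tendsto (fun k => ∑ l ∈ J with ρ k l = a, w k l) atTop (𝓝 (p a)) :=
    fun a ha => tendsto_iff_dist_tendsto_zero.2
      (squeeze_zero (fun _ => dist_nonneg) (fun k => (h2 k a ha).le) hε)
  rw [ProbabilityMeasure.tendsto_iff_forall_integral_tendsto]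
  intro f
  have hint : ∀ (k : ℕ) (f : X →ᵇ ℝ), ∫ x, f x ∂(g k : Measure X) = ∑ l ∈ J, w k l * f (z k l) :=
    fun k f => by rw [h3 k]; exact integral_finset_sum_dirac J _ (fun l hl => (h1 k l hl).1) f
  have hone : ∀ k, ∑ l ∈ J, w k l = 1 := fun k => by
    have := hint k (BoundedContinuousFunction.const X 1)
    simpa using this.symm
  have hmain : Tendsto (fun k => ∑ l ∈ J, w k l * f (ρ k l)) atTop
      (𝓝 (∫ x, f x ∂(g₀ : Measure X))) := by
    have : ∀ k, ∑ l ∈ J, w k l * f (ρ k l) = ∑ a ∈ s, (∑ l ∈ J with ρ k l = a, w k l) * f a := by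
      intro k
      rw [← Finset.sum_fiberwise_of_maps_to (fun l hl => (h1 k l hl).2.1)]
      refine Finset.sum_congr rfl fun a _ => ?_
      rw [Finset.sum_mul]
      exact Finset.sum_congr rfl fun l hl => by rw [(Finset.mem_filter.1 hl).2]
    simp_rw [this, hg₀ f]
    exact tendsto_finsetSum _ fun a ha => (hmass a ha).mul_const _
  have herr : Tendsto (fun k => ∑ l ∈ J, w k l * (f (z k l) - f (ρ k l))) atTop (𝓝 0) := by
    rw [Metric.tendsto_atTop']
    intro η hη
    -- Continuity at the finitely many points of `s` suffices; `f` need not be uniformly continuous.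
    have hmod : ∀ a ∈ s, ∃ δ > 0, ∀ x, dist x a < δ → dist (f x) (f a) < η / 2 := fun a _ =>
      Metric.continuous_iff.1 f.continuous a (η / 2) (half_pos hη)
    have hev : ∀ᶠ k : ℕ in atTop, ∀ a ∈ s, ∀ x, dist x a < 1 / ((k : ℝ) + 1) →
        dist (f x) (f a) < η / 2 := by
      rw [Filter.eventually_all_finset]
      intro a ha
      obtain ⟨δ, hδ, h⟩ := hmod a ha
      filter_upwards [hε.eventually (gt_mem_nhds hδ)] with k hk x hx
      exact h x (hx.trans hk)
    obtain ⟨K, hK⟩ := eventually_atTop.1 hev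
    refine ⟨K, fun k hk => ?_⟩
    rw [Real.dist_eq, sub_zero]
    calc |∑ l ∈ J, w k l * (f (z k l) - f (ρ k l))|
        ≤ ∑ l ∈ J, |w k l * (f (z k l) - f (ρ k l))| := Finset.abs_sum_le_sum_abs _ _
      _ ≤ ∑ l ∈ J, w k l * (η / 2) := Finset.sum_le_sum fun l hl => by
          obtain ⟨a1, a2, a3⟩ := h1 k l hl
          rw [abs_mul, abs_of_nonneg a1]
          exact mul_le_mul_of_nonneg_left (hK k hk.le _ a2 _ a3).le a1
      _ = η / 2 := by rw [← Finset.sum_mul, hone, one_mul]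
      _ < η := half_lt_self hη
  have := hmain.add herr
  rw [add_zero] at this
  refine this.congr fun k => ?_
  rw [hint, ← Finset.sum_add_distrib]
  exact Finset.sum_congr rfl fun l _ => by ring

/-- Finite atomic probability measures are weakly dense. -/
theorem exists_atomic_mem_of_isOpen (G₀ : ProbabilityMeasure X) {U : Set (ProbabilityMeasure X)}
    (hU : IsOpen U) (hG₀ : G₀ ∈ U) :
    ∃ g₀ ∈ U, ∃ (s : Finset X) (p : X → ℝ), (∀ a ∈ s, 0 < p a) ∧
      ∀ f : X →ᵇ ℝ, ∫ x, f x ∂(g₀ : Measure X) = ∑ a ∈ s, p a * f a := by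
  classical
  obtain ⟨x₀⟩ : Nonempty X := (G₀ : Measure X).nonempty_of_neZero
  let S : ℕ → SimpleFunc X X := fun k =>
    SimpleFunc.approxOn id measurable_id Set.univ x₀ (Set.mem_univ _) k
  have hS : ∀ x, Tendsto (fun k => S k x) atTop (𝓝 x) := fun x =>
    SimpleFunc.tendsto_approxOn measurable_id (Set.mem_univ x₀) (by simp)
  let g : ℕ → ProbabilityMeasure X := fun k => G₀.map (S k).measurable.aemeasurable
  have hg : Tendsto g atTop (𝓝 G₀) := by
    rw [ProbabilityMeasure.tendsto_iff_forall_integral_tendsto]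
    intro f
    have : ∀ k, ∫ x, f x ∂(g k : Measure X) = ∫ x, f (S k x) ∂(G₀ : Measure X) := fun k =>
      integral_map (S k).measurable.aemeasurable f.continuous.aestronglyMeasurable
    simp_rw [this]
    refine tendsto_integral_of_dominated_convergence (fun _ => ‖f‖)
      (fun k => (f.continuous.measurable.comp (S k).measurable).aestronglyMeasurable)
      (integrable_const _) (fun k => Eventually.of_forall fun x => f.norm_coe_le_norm _)
      (Eventually.of_forall fun x => (f.continuous.tendsto x).comp (hS x))
  obtain ⟨k, hk⟩ := (hg.eventually (hU.mem_nhds hG₀)).exists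
  let p : X → ℝ := fun a => (G₀ : Measure X).real (S k ⁻¹' {a})
  have hp : ∀ a, 0 ≤ p a := fun a => measureReal_nonneg
  refine ⟨g k, hk, (S k).range.filter fun a => 0 < p a, p, fun a ha => (Finset.mem_filter.1 ha).2,
    fun f => ?_⟩
  have h1 : ∫ x, f x ∂(g k : Measure X) = ∫ x, f (S k x) ∂(G₀ : Measure X) :=
    integral_map (S k).measurable.aemeasurable f.continuous.aestronglyMeasurable
  have h2 : ∀ x, f (S k x) = ∑ a ∈ (S k).range, (S k ⁻¹' {a}).indicator (fun _ => f a) x := by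
    intro x
    rw [Finset.sum_eq_single (S k x)]
    · simp
    · intro a _ ha
      rw [Set.indicator_of_notMem]
      exact fun h => ha (Set.mem_singleton_iff.1 h).symm
    · exact fun h => absurd ((S k).mem_range_self x) h
  simp_rw [h1, h2]
  rw [integral_finsetSum _ fun a _ =>
    (integrable_const (f a)).indicator ((S k).measurableSet_fiber a), Finset.sum_filter]
  refine Finset.sum_congr rfl fun a _ => ?_
  rw [integral_indicator_const _ ((S k).measurableSet_fiber a), smul_eq_mul]
  split_ifs with h
  · rfl
  · have : p a = 0 := le_antisymm (not_lt.1 h) (hp a)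
    simp only [p] at this
    rw [this, zero_mul]

end WeakTopology

/-- Used to give distinct locations to atoms of `Θ × ℝ≥0` that may share their first coordinate. -/
theorem exists_injOn_mem {α β : Type*} [Nonempty β] (s : Finset α) (S : α → Set β)
    (hS : ∀ a ∈ s, (S a).Infinite) : ∃ x : α → β, (∀ a ∈ s, x a ∈ S a) ∧ Set.InjOn x s := by
  classical
  induction s using Finset.induction_on with
  | empty =>
    exact ⟨fun _ => Classical.arbitrary β, by simp, by simp⟩
  | insert b s hb ih =>
    obtain ⟨x, hx, hinj⟩ := ih fun a ha => hS a (Finset.mem_insert_of_mem ha)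
    obtain ⟨y, hy, hy'⟩ := (hS b (Finset.mem_insert_self b s)).exists_notMem_finset (s.image x)
    have hne : ∀ a ∈ s, a ≠ b := fun a ha h => hb (h ▸ ha)
    refine ⟨Function.update x b y, fun a ha => ?_, ?_⟩
    · rcases Finset.mem_insert.1 ha with rfl | ha
      · simpa using hy
      · simpa [Function.update_of_ne (hne a ha)] using hx a ha
    · rw [Finset.coe_insert, Set.injOn_insert (by simpa using hb)]
      refine ⟨fun a ha a' ha' h => hinj ha ha' ?_, ?_⟩
      · simpa [Function.update_of_ne (hne a ha), Function.update_of_ne (hne a' ha')] using h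
      · rintro ⟨a, ha, h⟩
        rw [Function.update_of_ne (hne a ha), Function.update_self] at h
        exact hy' (Finset.mem_image.2 ⟨a, ha, h⟩)

/-! ### Support of the random rows and scales. -/

theorem sbaKernel_apply {Θ : Set ℝ} (H : ℕ → ProbabilityMeasure Θ) (j : ℕ) (x : SBARow Θ j) :
    sbaKernel H j x = Measure.pi fun l : Finset.Icc 1 (2 ^ (j + 1 - 1)) =>
      (H (2 * (l : ℕ) - 1) : Measure Θ)[|sbaCell x l] := by
  unfold sbaKernel
  rw [Kernel.coe_mk]

instance {Θ : Set ℝ} (H : ℕ → ProbabilityMeasure Θ) (j : ℕ) : IsFiniteKernel (sbaKernel H j) := by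
  refine ⟨1, ENNReal.one_lt_top, fun x => ?_⟩
  rw [sbaKernel_apply, Measure.pi_univ]
  -- Conditioning on a null cell gives the zero measure, so the kernel is only known to be
  -- sub-Markov.
  exact Finset.prod_le_one' fun l _ => prob_le_one

theorem continuous_sbaNode {Θ : Set ℝ} {j : ℕ} (l : ℕ) :
    Continuous (fun x : SBARow Θ j => sbaNode x l) := by
  unfold sbaNode
  split_ifs with h h0
  · exact continuous_coe_real_ereal.comp (continuous_subtype_val.comp (continuous_apply _))
  · exact continuous_const
  · exact continuous_const

theorem sbaNode_of_mem {Θ : Set ℝ} {j : ℕ} (x : SBARow Θ j) {l : ℕ}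
    (h : l ∈ Finset.Icc 1 (2 ^ j - 1)) : sbaNode x l = ((x ⟨l, h⟩ : ℝ) : EReal) := dif_pos h

theorem half_mem_Icc {j k : ℕ} (hk : k ∈ Finset.Icc 1 (2 ^ (j + 1) - 1)) (he : Even k) :
    k / 2 ∈ Finset.Icc 1 (2 ^ j - 1) := by
  obtain ⟨q, rfl⟩ := he
  simp only [Finset.mem_Icc, pow_succ] at hk ⊢
  omega

theorem succ_half_mem_Icc {j k : ℕ} (hk : k ∈ Finset.Icc 1 (2 ^ (j + 1) - 1)) (he : ¬ Even k) :
    (k + 1) / 2 ∈ Finset.Icc 1 (2 ^ (j + 1 - 1)) := by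
  obtain ⟨q, rfl⟩ := Nat.not_even_iff_odd.1 he
  simp only [Finset.mem_Icc, pow_succ, Nat.add_sub_cancel] at hk ⊢
  omega

/-- The row of level `j + 1` with the row of level `j` at its even positions and the new entries at
its odd positions. -/
def sbaMerge {Θ : Set ℝ} {j : ℕ} (q : SBARow Θ j × (Finset.Icc 1 (2 ^ (j + 1 - 1)) → Θ)) :
    SBARow Θ (j + 1) := fun k =>
  if he : Even (k : ℕ) then q.1 ⟨k / 2, half_mem_Icc k.2 he⟩
  else q.2 ⟨(k + 1) / 2, succ_half_mem_Icc k.2 he⟩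

theorem continuous_sbaMerge {Θ : Set ℝ} {j : ℕ} : Continuous (sbaMerge (Θ := Θ) (j := j)) := by
  refine continuous_pi fun k => ?_
  unfold sbaMerge
  split_ifs
  · exact (continuous_apply _).comp continuous_fst
  · exact (continuous_apply _).comp continuous_snd

/-- Each `z l` is interior to its cell, so the cell meets `B l` in a neighbourhood of a point of the
support. -/
theorem sbaKernel_pi_pos {Θ : Set ℝ} {H : ℕ → ProbabilityMeasure Θ} {j : ℕ}
    (hH : ∀ l ∈ Finset.Icc 1 (2 ^ (j + 1 - 1)), (H (2 * l - 1) : Measure Θ).support = Set.univ)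
    {x : SBARow Θ j} {z : Finset.Icc 1 (2 ^ (j + 1 - 1)) → Θ}
    (hz : ∀ l : Finset.Icc 1 (2 ^ (j + 1 - 1)), sbaNode x ((l : ℕ) - 1) < ((z l : ℝ) : EReal) ∧
      ((z l : ℝ) : EReal) < sbaNode x l)
    {B : Finset.Icc 1 (2 ^ (j + 1 - 1)) → Set Θ} (hB : ∀ l, IsOpen (B l)) (hzB : ∀ l, z l ∈ B l) :
    sbaKernel H j x (Set.univ.pi B) ≠ 0 := by
  rw [sbaKernel_apply, Measure.pi_pi, Finset.prod_ne_zero_iff]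
  intro l _
  rw [cond_apply (measurableSet_sbaCell _ _)]
  refine mul_ne_zero (ENNReal.inv_ne_zero.2 (measure_ne_top _ _)) (ne_of_gt ?_)
  have hmem : z l ∈ (H (2 * (l : ℕ) - 1) : Measure Θ).support := by
    rw [hH l l.2]; exact Set.mem_univ _
  refine (Measure.mem_support_iff_forall _).1 hmem _ (Filter.inter_mem ?_ ((hB l).mem_nhds (hzB l)))
  have hc : Continuous fun t : Θ => ((t : ℝ) : EReal) :=
    continuous_coe_real_ereal.comp continuous_subtype_val
  filter_upwards [hc.continuousAt.eventually (lt_mem_nhds (hz l).1),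
    hc.continuousAt.eventually (gt_mem_nhds (hz l).2)] with t h1 h2
  exact ⟨h1, h2.le⟩

namespace IsDSBASpOf

variable {Θ : Set ℝ} {Ω : Type*} [MeasurableSpace Ω] {Pr : Measure Ω}
  {n : ℕ} {H : ℕ → ℕ → ProbabilityMeasure Θ} {P : ProbabilityMeasure ℝ≥0}
  {G : Ω → ProbabilityMeasure (Θ × ℝ≥0)} {μ : ℕ → ℕ → Ω → Θ} {φ : ℕ → Ω → ℝ≥0}

theorem sbaRow_succ_ae_eq (h : IsDSBASpOf Pr n H P G μ φ) {j : ℕ} (hj : 1 ≤ j) (hjn : j ≤ n) :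
    ∀ᵐ ω ∂Pr, sbaRow μ (j + 1) ω = sbaMerge (sbaRow μ j ω, sbaNewEntries μ (j + 1) ω) := by
  have := (Filter.eventually_all_finset _).2
    (h.inherit (j + 1) (Finset.mem_Icc.2 ⟨by omega, by omega⟩))
  filter_upwards [this] with ω hω
  funext ⟨k, hk⟩
  simp only [sbaRow, sbaMerge, sbaNewEntries]
  split_ifs with he
  · have := hω (k / 2) (half_mem_Icc hk he)
    rwa [Nat.two_mul_div_two_of_even he, Nat.add_sub_cancel] at this
  · obtain ⟨q, rfl⟩ := Nat.not_even_iff_odd.1 he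
    rw [show 2 * ((2 * q + 1 + 1) / 2) - 1 = 2 * q + 1 by omega]

/-- Every row that is strictly increasing, and does not reach the endpoints of `Θ`, lies in the
support of the random row. -/
theorem measure_sbaRow_pos [IsProbabilityMeasure Pr] (h : IsDSBASpOf Pr n H P G μ φ)
    (hH : ∀ j ∈ Finset.Icc 1 (n + 1), ∀ l ∈ Finset.Icc 1 (2 ^ (j - 1)),
      (H j (2 * l - 1) : Measure Θ).support = Set.univ) {j : ℕ} (hj : 1 ≤ j) :
    j ≤ n + 1 → ∀ x : SBARow Θ j,
      (∀ l ∈ Finset.Icc 1 (2 ^ j), sbaNode x (l - 1) < sbaNode x l) →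
      ∀ V : Set (SBARow Θ j), IsOpen V → x ∈ V → 0 < Pr {ω | sbaRow μ j ω ∈ V} := by
  induction j, hj using Nat.le_induction with
  | base =>
    intro hn x _ V hV hxV
    let c : Θ → SBARow Θ 1 := fun t _ => t
    have hc : Continuous c := continuous_pi fun _ => continuous_id
    have hrow : ∀ (y : SBARow Θ 1) (h1 : 1 ∈ Finset.Icc 1 (2 ^ 1 - 1)), c (y ⟨1, h1⟩) = y := by
      intro y h1
      funext ⟨k, hk⟩
      obtain rfl : k = 1 := by simpa using hk
      rfl
    have h1 : 1 ∈ Finset.Icc 1 (2 ^ 1 - 1) := by simp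
    have hset : {ω | sbaRow μ 1 ω ∈ V} = {ω | μ 1 1 ω ∈ c ⁻¹' V} := by
      ext ω
      have := hrow (sbaRow μ 1 ω) h1
      change sbaRow μ 1 ω ∈ V ↔ c (μ 1 1 ω) ∈ V
      rw [← this]; rfl
    rw [hset, h.root.measure_eq (p := fun t => t ∈ c ⁻¹' V) (hV.preimage hc).measurableSet]
    have hmem : x ⟨1, h1⟩ ∈ (H 1 1 : Measure Θ).support := by
      have := hH 1 (by simp) 1 (by simp)
      rw [show (1 : ℕ) = 2 * 1 - 1 by rfl] at *
      rw [this]; exact Set.mem_univ _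
    refine (Measure.mem_support_iff_forall _).1 hmem _ ((hV.preimage hc).mem_nhds ?_)
    change c (x ⟨1, h1⟩) ∈ V
    rwa [hrow x h1]
  | succ j hj ih =>
    intro hn x hx V hV hxV
    have hp : 2 ^ (j + 1) = 2 * 2 ^ j := by ring
    have hp1 := Nat.two_pow_pos j
    let y : SBARow Θ j := fun l => x ⟨2 * (l : ℕ), by
      have := Finset.mem_Icc.1 l.2; exact Finset.mem_Icc.2 (by omega)⟩
    let z : Finset.Icc 1 (2 ^ (j + 1 - 1)) → Θ := fun l => x ⟨2 * (l : ℕ) - 1, by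
      have := Finset.mem_Icc.1 l.2
      have e : j + 1 - 1 = j := rfl
      simp only [e] at this; exact Finset.mem_Icc.2 (by omega)⟩
    have hyz : sbaMerge (y, z) = x := by
      funext ⟨k, hk⟩
      simp only [sbaMerge, y, z]
      split_ifs with he
      · congr 2; exact Nat.two_mul_div_two_of_even he
      · obtain ⟨q, rfl⟩ := Nat.not_even_iff_odd.1 he
        congr 2; omega
    have hynode : ∀ l ≤ 2 ^ j, sbaNode y l = sbaNode x (2 * l) := by
      intro l hl
      unfold sbaNode
      simp only [Finset.mem_Icc]
      split_ifs <;> first | rfl | omega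
    have hznode : ∀ l : Finset.Icc 1 (2 ^ (j + 1 - 1)),
        sbaNode x (2 * (l : ℕ) - 1) = ((z l : ℝ) : EReal) := fun l => sbaNode_of_mem x _
    have hbetween : ∀ l : Finset.Icc 1 (2 ^ (j + 1 - 1)),
        sbaNode y ((l : ℕ) - 1) < ((z l : ℝ) : EReal) ∧ ((z l : ℝ) : EReal) < sbaNode y l := by
      intro l
      have hl := Finset.mem_Icc.1 l.2
      have e : j + 1 - 1 = j := rfl
      simp only [e] at hl
      rw [← hznode, hynode _ (by omega), hynode _ (by omega),
        show 2 * ((l : ℕ) - 1) = 2 * l - 1 - 1 by omega]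
      exact ⟨hx _ (Finset.mem_Icc.2 (by omega)), hx _ (Finset.mem_Icc.2 (by omega))⟩
    have hynode_lt : ∀ l ∈ Finset.Icc 1 (2 ^ j), sbaNode y (l - 1) < sbaNode y l := fun l hl =>
      (hbetween ⟨l, hl⟩).1.trans (hbetween ⟨l, hl⟩).2
    obtain ⟨u, v, hu, hv, hyu, hzv, huv⟩ := isOpen_prod_iff.1 (hV.preimage continuous_sbaMerge) y z
      (by rw [Set.mem_preimage, hyz]; exact hxV)
    obtain ⟨B, hB, hBv⟩ := isOpen_pi_iff'.1 hv z hzv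
    -- Old rows near `y` whose nodes still interlace with the fixed new entries `z`; an open
    -- condition, by continuity of the nodes.
    let A : Set (SBARow Θ j) := u ∩ {y' | ∀ l : Finset.Icc 1 (2 ^ (j + 1 - 1)),
      sbaNode y' ((l : ℕ) - 1) < ((z l : ℝ) : EReal) ∧ ((z l : ℝ) : EReal) < sbaNode y' l}
    have hA : A ∈ nhds y := by
      refine Filter.inter_mem (hu.mem_nhds hyu) (Filter.eventually_all.2 fun l => ?_)
      exact ((continuous_sbaNode _).continuousAt.eventually (gt_mem_nhds (hbetween l).1)).and
        ((continuous_sbaNode _).continuousAt.eventually (lt_mem_nhds (hbetween l).2))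
    obtain ⟨A', hA'A, hA', hyA'⟩ := mem_nhds_iff.1 hA
    have hBm : MeasurableSet (Set.univ.pi B) :=
      MeasurableSet.univ_pi fun l => (hB l).1.measurableSet
    have hsplit := h.split j (Finset.mem_Icc.2 ⟨hj, by omega⟩)
    have hpos : 0 < Pr {ω | (sbaRow μ j ω, sbaNewEntries μ (j + 1) ω) ∈ A' ×ˢ Set.univ.pi B} := by
      rw [HasLaw.measure_eq (p := fun q => q ∈ A' ×ˢ Set.univ.pi B) hsplit
        (hA'.measurableSet.prod hBm)]
      change 0 < (Pr.map (sbaRow μ j) ⊗ₘ sbaKernel (H (j + 1)) j) (A' ×ˢ Set.univ.pi B)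
      rw [Measure.compProd_apply_prod hA'.measurableSet hBm,
        setLIntegral_pos_iff (Kernel.measurable_coe _ hBm)]
      -- The integrand is positive throughout `A'`, so the integral is positive as soon as `A'` is
      -- charged, which is the induction hypothesis.
      have hsub : A' ⊆ Function.support fun y' => sbaKernel (H (j + 1)) j y' (Set.univ.pi B) :=
        fun y' hy' => sbaKernel_pi_pos (hH (j + 1) (Finset.mem_Icc.2 ⟨by omega, hn⟩))
          (hA'A hy').2 (fun l => (hB l).1) fun l => (hB l).2
      rw [Set.inter_eq_right.2 hsub,
        Measure.map_apply_of_aemeasurable hsplit.aemeasurable_fst hA'.measurableSet]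
      exact ih (by omega) y hynode_lt A' hA' hyA'
    refine hpos.trans_le (measure_mono_ae ?_)
    filter_upwards [h.sbaRow_succ_ae_eq hj (by omega)] with ω hω hmem
    change sbaRow μ (j + 1) ω ∈ V
    rw [hω]
    exact huv (Set.mk_mem_prod (hA'A hmem.1).1 (hBv hmem.2))

theorem measure_sbaRow_scale_pos [IsProbabilityMeasure Pr] (h : IsDSBASpOf Pr n H P G μ φ)
    (hH : ∀ j ∈ Finset.Icc 1 (n + 1), ∀ l ∈ Finset.Icc 1 (2 ^ (j - 1)),
      (H j (2 * l - 1) : Measure Θ).support = Set.univ)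
    (hP : (P : Measure ℝ≥0).support = Set.univ) {x : SBARow Θ (n + 1)}
    (hx : ∀ l ∈ Finset.Icc 1 (2 ^ (n + 1)), sbaNode x (l - 1) < sbaNode x l)
    {y : Finset.Icc 1 (2 ^ n) → ℝ≥0} {V : Set (SBARow Θ (n + 1))}
    {W : Set (Finset.Icc 1 (2 ^ n) → ℝ≥0)} (hV : V ∈ nhds x) (hW : W ∈ nhds y) :
    0 < Pr {ω | sbaRow μ (n + 1) ω ∈ V ∧ (fun l : Finset.Icc 1 (2 ^ n) => φ l ω) ∈ W} := by
  obtain ⟨V', hVV', hV', hxV'⟩ := mem_nhds_iff.1 hV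
  obtain ⟨W', hWW', hW', hyW'⟩ := mem_nhds_iff.1 hW
  have : (P : Measure ℝ≥0).IsOpenPosMeasure := ⟨fun O hO ⟨a, ha⟩ => by
    have hmem : a ∈ (P : Measure ℝ≥0).support := by rw [hP]; exact Set.mem_univ _
    exact ((Measure.mem_support_iff_forall _).1 hmem _ (hO.mem_nhds ha)).ne'⟩
  have h1 := h.measure_sbaRow_pos hH (by omega) le_rfl x hx V' hV' hxV'
  have h2 : 0 < Pr {ω | (fun l : Finset.Icc 1 (2 ^ n) => φ l ω) ∈ W'} := by
    rw [h.scale.measure_eq (p := fun q => q ∈ W') hW'.measurableSet]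
    exact hW'.measure_pos _ ⟨y, hyW'⟩
  have h3 := h.indep.measure_inter_preimage_eq_mul V' W' hV'.measurableSet hW'.measurableSet
  refine (ENNReal.mul_pos h1.ne' h2.ne').trans_le (h3.symm.le.trans (measure_mono ?_))
  exact fun ω hω => ⟨hVV' hω.1, hWW' hω.2⟩

end IsDSBASpOf

/-! ### From rows to the random measure. -/

/-- The array of levels `1, …, n + 1` read off from its row of level `n + 1`. -/
noncomputable def sbaArrayOfRow {Θ : Set ℝ} {n : ℕ} (x : SBARow Θ (n + 1)) (j k : ℕ) : ℝ :=
  if h : k * 2 ^ (n + 1 - j) ∈ Finset.Icc 1 (2 ^ (n + 1) - 1) then (x ⟨_, h⟩ : ℝ) else 0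

theorem mul_two_pow_mem_Icc {j k m : ℕ} (hj : j ≤ m) (hk : k ∈ Finset.Icc 1 (2 ^ j - 1)) :
    k * 2 ^ (m - j) ∈ Finset.Icc 1 (2 ^ m - 1) := by
  obtain ⟨d, rfl⟩ := Nat.exists_eq_add_of_le hj
  simp only [Finset.mem_Icc, Nat.add_sub_cancel_left] at hk ⊢
  have h1 := Nat.two_pow_pos d
  have h2 := Nat.two_pow_pos j
  have h3 : k * 2 ^ d ≤ (2 ^ j - 1) * 2 ^ d := Nat.mul_le_mul_right _ hk.2
  rw [Nat.sub_mul, one_mul, ← pow_add] at h3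
  have h4 : 1 * 1 ≤ k * 2 ^ d := Nat.mul_le_mul hk.1 h1
  omega

open Filter Topology in
theorem tendsto_sbaArrayOfRow {Θ : Set ℝ} {n : ℕ} {x : SBARow Θ (n + 1)} {r : ℕ → ℝ}
    (hr : ∀ k : Finset.Icc 1 (2 ^ (n + 1) - 1), (x k : ℝ) = r k) :
    ∀ j ∈ Finset.Icc 1 (n + 1), ∀ k ∈ Finset.Icc 1 (2 ^ j - 1),
      Tendsto (fun x' : SBARow Θ (n + 1) => sbaArrayOfRow x' j k) (𝓝 x)
        (𝓝 (r (k * 2 ^ (n + 1 - j)))) := by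
  intro j hj k hk
  have h := mul_two_pow_mem_Icc (Finset.mem_Icc.1 hj).2 hk
  simp only [sbaArrayOfRow, h, dif_pos]
  rw [← hr ⟨_, h⟩]
  exact (continuous_subtype_val.comp (continuous_apply _)).tendsto x

/-- Iterated inheritance identifies `μ j k` with `μ (n + 1) (k * 2 ^ (n + 1 - j))` almost surely, so
the weights depend on the last row alone. -/
theorem IsDSBASpOf.sbaWeight_ae_eq {Θ : Set ℝ} {Ω : Type*} [MeasurableSpace Ω] {Pr : Measure Ω}
    {n : ℕ} {H : ℕ → ℕ → ProbabilityMeasure Θ} {P : ProbabilityMeasure ℝ≥0}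
    {G : Ω → ProbabilityMeasure (Θ × ℝ≥0)} {μ : ℕ → ℕ → Ω → Θ} {φ : ℕ → Ω → ℝ≥0}
    (h : IsDSBASpOf Pr n H P G μ φ) :
    ∀ᵐ ω ∂Pr, ∀ l ∈ Finset.Icc 1 (2 ^ n), sbaWeight (fun j k => (μ j k ω : ℝ)) n l =
      sbaWeight (sbaArrayOfRow (sbaRow μ (n + 1) ω)) n l := by
  have h1 := (Filter.eventually_all_finset _).2 fun j hj =>
    (Filter.eventually_all_finset _).2 (h.inherit j hj)
  filter_upwards [h1] with ω hω l hl
  have key : ∀ d j, j + d = n + 1 → 1 ≤ j → ∀ k ∈ Finset.Icc 1 (2 ^ j - 1),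
      μ j k ω = μ (n + 1) (k * 2 ^ d) ω := by
    intro d
    induction d with
    | zero => rintro j rfl _ k _; simp
    | succ d ih =>
      intro j hj hj1 k hk
      have hk' := Finset.mem_Icc.1 hk
      have h2 := hω (j + 1) (Finset.mem_Icc.2 ⟨by omega, by omega⟩) k hk
      rw [Nat.add_sub_cancel] at h2
      rw [← h2, ih (j + 1) (by omega) (by omega) (2 * k) (by
        rw [Finset.mem_Icc, pow_succ]; omega)]
      congr 1
      ring
  have hagree : ∀ j ∈ Finset.Icc 1 (n + 1), ∀ k ∈ Finset.Icc 1 (2 ^ j - 1),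
      (μ j k ω : ℝ) = sbaArrayOfRow (sbaRow μ (n + 1) ω) j k := by
    intro j hj k hk
    have hj' := Finset.mem_Icc.1 hj
    have hm := mul_two_pow_mem_Icc hj'.2 hk
    simp only [sbaArrayOfRow, hm, dif_pos, sbaRow]
    rw [key (n + 1 - j) j (by omega) hj'.1 k hk]
  have hl' := Finset.mem_Icc.1 hl
  unfold sbaWeight
  rw [sbaCDF_congr hagree n le_rfl l hl'.2, sbaCDF_congr hagree n le_rfl (l - 1) (by omega)]

theorem exists_lt_of_mem_interior {s : Set ℝ} {x : ℝ} (hx : x ∈ interior s) :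
    (∃ y ∈ s, y < x) ∧ ∃ y ∈ s, x < y := by
  obtain ⟨ε, hε, h⟩ := Metric.mem_nhds_iff.1 (mem_interior_iff_mem_nhds.1 hx)
  refine ⟨⟨x - ε / 2, h ?_, by linarith⟩, ⟨x + ε / 2, h ?_, by linarith⟩⟩ <;>
    rw [Metric.mem_ball, Real.dist_eq, abs_lt] <;> constructor <;> linarith

theorem sbaNode_lt_of_mem_interior {Θ : Set ℝ} {j : ℕ} (hj : 1 ≤ j) {x : SBARow Θ j} {r : ℕ → ℝ}
    (hr : ∀ k : Finset.Icc 1 (2 ^ j - 1), (x k : ℝ) = r k)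
    (hint : ∀ k ∈ Finset.Icc 1 (2 ^ j - 1), r k ∈ interior Θ)
    (hmono : ∀ k, 1 ≤ k → k + 1 < 2 ^ j → r k < r (k + 1)) :
    ∀ l ∈ Finset.Icc 1 (2 ^ j), sbaNode x (l - 1) < sbaNode x l := by
  have h2 : 2 ≤ 2 ^ j := by
    calc 2 = 2 ^ 1 := rfl
      _ ≤ 2 ^ j := Nat.pow_le_pow_right (by norm_num) hj
  intro l hl
  have hl' := Finset.mem_Icc.1 hl
  rcases hl'.1.eq_or_lt with rfl | h1
  · have hm : 1 ∈ Finset.Icc 1 (2 ^ j - 1) := Finset.mem_Icc.2 (by omega)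
    rw [sbaNode_of_mem x hm, hr]
    simp only [sbaNode, Nat.sub_self, Finset.mem_Icc]
    obtain ⟨y, hy, hlt⟩ := (exists_lt_of_mem_interior (hint 1 hm)).1
    exact iInf_lt_iff.2 ⟨⟨y, hy⟩, EReal.coe_lt_coe_iff.2 hlt⟩
  · have hm : l - 1 ∈ Finset.Icc 1 (2 ^ j - 1) := Finset.mem_Icc.2 (by omega)
    rw [sbaNode_of_mem x hm, hr]
    rcases hl'.2.eq_or_lt with rfl | h3
    · have hn : 2 ^ j ∉ Finset.Icc 1 (2 ^ j - 1) := by rw [Finset.mem_Icc]; omega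
      have h0 : 2 ^ j ≠ 0 := by positivity
      simp only [sbaNode, hn, h0, dif_neg, if_false, not_false_iff]
      obtain ⟨y, hy, hlt⟩ := (exists_lt_of_mem_interior (hint _ hm)).2
      exact lt_iSup_iff.2 ⟨⟨y, hy⟩, EReal.coe_lt_coe_iff.2 hlt⟩
    · rw [sbaNode_of_mem x (Finset.mem_Icc.2 (by omega)), hr, EReal.coe_lt_coe_iff]
      have := hmono (l - 1) (by omega) (by omega)
      rwa [show l - 1 + 1 = l by omega] at this

theorem sum_Icc_sub_one (f : ℕ → ℝ) (N : ℕ) :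
    ∑ l ∈ Finset.Icc 1 N, f (l - 1) = ∑ i ∈ Finset.range N, f i := by
  induction N with
  | zero => simp
  | succ N ih => rw [Finset.sum_Icc_succ_top (by omega), ih, Finset.sum_range_succ]; simp

theorem two_mul_sub_one_mem_Icc {n l : ℕ} (hl : l ∈ Finset.Icc 1 (2 ^ n)) :
    2 * l - 1 ∈ Finset.Icc 1 (2 ^ (n + 1) - 1) := by
  rw [Finset.mem_Icc] at *; rw [pow_succ]; omega

open Filter Topology in
theorem IsDSBASpOf.measure_mem_nhds_atomic_pos {Θ : Set ℝ} (hΘ_interval : Θ.OrdConnected)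
    (hΘ_nondeg : Θ.Nontrivial) {P : ProbabilityMeasure ℝ≥0}
    (hP : (P : Measure ℝ≥0).support = Set.univ) {g₀ : ProbabilityMeasure (Θ × ℝ≥0)}
    {s : Finset (Θ × ℝ≥0)} {p : Θ × ℝ≥0 → ℝ} (hp : ∀ a ∈ s, 0 < p a)
    (hg₀ : ∀ f : BoundedContinuousFunction (Θ × ℝ≥0) ℝ,
      ∫ x, f x ∂(g₀ : Measure (Θ × ℝ≥0)) = ∑ a ∈ s, p a * f a)
    {U : Set (ProbabilityMeasure (Θ × ℝ≥0))} (hU : U ∈ 𝓝 g₀) {n : ℕ} (hn : s.card ≤ n + 1)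
    {Ω : Type*} [MeasurableSpace Ω] {Pr : Measure Ω} [IsProbabilityMeasure Pr]
    {H : ℕ → ℕ → ProbabilityMeasure Θ}
    (hH : ∀ j ∈ Finset.Icc 1 (n + 1), ∀ l ∈ Finset.Icc 1 (2 ^ (j - 1)),
      (H j (2 * l - 1) : Measure Θ).support = Set.univ)
    {G : Ω → ProbabilityMeasure (Θ × ℝ≥0)} {μ : ℕ → ℕ → Ω → Θ} {φ : ℕ → Ω → ℝ≥0}
    (h : IsDSBASpOf Pr n H P G μ φ) : 0 < Pr (G ⁻¹' U) := by
  classical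
  obtain ⟨ε, hε, hclose⟩ := exists_pos_forall_atomic_mem_nhds (Finset.Icc 1 (2 ^ n)) hg₀ hU
  have hpsum : ∑ a ∈ s, p a = 1 := by
    simpa using (hg₀ (BoundedContinuousFunction.const _ 1)).symm
  have hs : s.Nonempty := by
    rw [Finset.nonempty_iff_ne_empty]; rintro rfl; simp at hpsum
  have hclosure : Θ ⊆ closure (interior Θ) := by
    have hint : (interior Θ).Nonempty := by
      obtain ⟨a, ha, b, hb, hab⟩ := hΘ_nondeg.exists_lt
      exact ⟨(a + b) / 2, mem_interior.2 ⟨Set.Ioo a b,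
        Set.Ioo_subset_Icc_self.trans (hΘ_interval.out ha hb), isOpen_Ioo,
        by constructor <;> linarith⟩⟩
    have hconv : Convex ℝ Θ := hΘ_interval.convex
    rw [hconv.closure_interior_eq_closure_of_nonempty_interior hint]
    exact subset_closure
  -- Interior points near a given location form a nonempty open set, hence an infinite one.
  obtain ⟨x, hx, hxinj⟩ := exists_injOn_mem s
    (fun a => interior Θ ∩ Metric.ball ((a.1 : Θ) : ℝ) (ε / 2)) (by
      intro a _
      obtain ⟨y, hy, hya⟩ := Metric.mem_closure_iff.1 (hclosure a.1.2) (ε / 2) (half_pos hε)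
      refine infinite_of_mem_nhds y ((isOpen_interior.inter Metric.isOpen_ball).mem_nhds ⟨hy, ?_⟩)
      rwa [Metric.mem_ball, dist_comm])
  obtain ⟨δ, hδ, hδε, hδx⟩ : ∃ δ > 0, δ < ε / 2 ∧ ∀ a ∈ s, Metric.ball (x a) δ ⊆ interior Θ := by
    have h1 : ∀ᶠ δ : ℝ in 𝓝[>] 0, ∀ a ∈ s, Metric.ball (x a) δ ⊆ interior Θ := by
      rw [Filter.eventually_all_finset]
      intro a ha
      obtain ⟨η, hη, hsub⟩ := Metric.isOpen_iff.1 isOpen_interior (x a) (hx a ha).1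
      filter_upwards [Ioo_mem_nhdsGT hη] with δ hδ
      exact (Metric.ball_subset_ball hδ.2.le).trans hsub
    obtain ⟨δ, h1, h2⟩ := (h1.and (Ioo_mem_nhdsGT (half_pos hε))).exists
    exact ⟨δ, h2.1, h2.2, h1⟩
  obtain ⟨t, w, ρ, hleaf, hfiber, -, hsep⟩ := exists_dyadicallySeparated n s p x δ hs hn hp hxinj hδ
  have hw : ∀ i < 2 ^ n, 0 < w i := fun i hi => (hleaf i hi).2.1
  have hwsum : ∑ i ∈ Finset.range (2 ^ n), w i = 1 := by
    simpa [hpsum] using hfiber fun _ => 1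
  have hpn : 2 ^ (n + 1) = 2 * 2 ^ n := by ring
  have hpos := Nat.two_pow_pos n
  set r := dyadicMean t w with hr
  have hrodd : ∀ i < 2 ^ n, r (2 * i + 1) = t i := fun i hi => dyadicMean_odd (hw i hi).ne'
  have htint : ∀ i < 2 ^ n, t i ∈ interior Θ := fun i hi =>
    hδx _ (hleaf i hi).1 (by rw [Metric.mem_ball, Real.dist_eq]; exact (hleaf i hi).2.2)
  -- All barycenters lie between the extreme atoms, and the interior of an interval is an interval.
  have hrint : ∀ k ∈ Finset.Icc 1 (2 ^ (n + 1) - 1), r k ∈ interior Θ := by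
    intro k hk
    obtain ⟨hk1, hk2⟩ := Finset.mem_Icc.1 hk
    have hfirst : r 1 = t 0 := hrodd 0 hpos
    have hlast : r (2 ^ (n + 1) - 1) = t (2 ^ n - 1) := by
      rw [← hrodd _ (by omega)]; congr 1; omega
    refine hΘ_interval.interior.out (htint 0 hpos) (htint (2 ^ n - 1) (by omega)) ⟨?_, ?_⟩
    · rw [← hfirst]
      rcases hk1.eq_or_lt with rfl | hlt
      · exact le_rfl
      · exact (hsep.dyadicMean_lt hw le_rfl hlt (by omega)).le
    · rw [← hlast]
      rcases hk2.eq_or_lt with rfl | hlt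
      · exact le_rfl
      · exact (hsep.dyadicMean_lt hw hk1 hlt (by omega)).le
  let row : SBARow Θ (n + 1) := fun k => ⟨r k, interior_subset (hrint k k.2)⟩
  let scales : Finset.Icc 1 (2 ^ n) → ℝ≥0 := fun l => (ρ (l - 1)).2
  have hweight := fun l hl => hsep.tendsto_sbaWeight hw hwsum
    (tendsto_sbaArrayOfRow (x := row) fun _ => rfl) (l := l) hl
  have hρ : ∀ l ∈ Finset.Icc 1 (2 ^ n), ρ (l - 1) ∈ s := fun l hl =>
    (hleaf (l - 1) (by have := Finset.mem_Icc.1 hl; omega)).1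
  have hV1 : ∀ᶠ x' in 𝓝 row, ∀ l ∈ Finset.Icc 1 (2 ^ n),
      0 ≤ sbaWeight (sbaArrayOfRow x') n l := by
    rw [Filter.eventually_all_finset]
    intro l hl
    have := hw (l - 1) (by have := Finset.mem_Icc.1 hl; omega)
    exact ((hweight l hl).eventually (lt_mem_nhds this)).mono fun _ h => h.le
  have hV2 : ∀ᶠ x' in 𝓝 row, ∀ l : Finset.Icc 1 (2 ^ n),
      dist (x' ⟨2 * (l : ℕ) - 1, two_mul_sub_one_mem_Icc l.2⟩) (ρ ((l : ℕ) - 1)).1 < ε := by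
    rw [Filter.eventually_all]
    rintro ⟨l, hl⟩
    have hl' := Finset.mem_Icc.1 hl
    have hc : Continuous fun x' : SBARow Θ (n + 1) =>
        dist (x' ⟨2 * l - 1, two_mul_sub_one_mem_Icc hl⟩) (ρ (l - 1)).1 :=
      (continuous_apply _).dist continuous_const
    refine hc.continuousAt.eventually (gt_mem_nhds ?_)
    have ht : r (2 * l - 1) = t (l - 1) := by
      rw [← hrodd (l - 1) (by omega)]; congr 1; omega
    change dist (r (2 * l - 1)) ((ρ (l - 1)).1 : ℝ) < ε
    rw [ht]
    have h1 := (hleaf (l - 1) (by omega)).2.2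
    have h2 := Metric.mem_ball.1 (hx _ (hρ l hl)).2
    rw [← Real.dist_eq] at h1
    linarith [dist_triangle (t (l - 1)) (x (ρ (l - 1))) ((ρ (l - 1)).1 : ℝ)]
  have hV3 : ∀ᶠ x' in 𝓝 row, ∀ a ∈ s,
      dist (∑ l ∈ Finset.Icc 1 (2 ^ n) with ρ (l - 1) = a, sbaWeight (sbaArrayOfRow x') n l)
        (p a) < ε := by
    rw [Filter.eventually_all_finset]
    intro a ha
    have hlim := tendsto_finsetSum ((Finset.Icc 1 (2 ^ n)).filter fun l => ρ (l - 1) = a)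
      fun l hl => hweight l (Finset.mem_filter.1 hl).1
    -- Preservation of sums over labels, tested on the indicator of `a`.
    have hpa : ∑ l ∈ Finset.Icc 1 (2 ^ n) with ρ (l - 1) = a, w (l - 1) = p a := by
      have h1 := sum_Icc_sub_one (fun i => if ρ i = a then w i else 0) (2 ^ n)
      have h2 := hfiber fun b => if b = a then 1 else 0
      simp only [mul_ite, mul_one, mul_zero, Finset.sum_ite_eq', ha, if_true] at h2
      rw [Finset.sum_filter, h1, h2]
    rw [hpa] at hlim
    exact hlim.eventually (Metric.ball_mem_nhds _ hε)
  have hW : ∀ᶠ y in 𝓝 scales, ∀ l : Finset.Icc 1 (2 ^ n),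
      dist (y l) (ρ ((l : ℕ) - 1)).2 < ε := by
    rw [Filter.eventually_all]
    intro l
    have hc : Continuous fun y : Finset.Icc 1 (2 ^ n) → ℝ≥0 => dist (y l) (ρ ((l : ℕ) - 1)).2 :=
      (continuous_apply _).dist continuous_const
    refine hc.continuousAt.eventually (gt_mem_nhds ?_)
    simpa [scales] using hε
  have hnode := sbaNode_lt_of_mem_interior (Nat.le_add_left 1 n) (x := row) (fun _ => rfl) hrint
    fun k hk hk' => hsep.dyadicMean_lt_succ hw hk hk'
  refine (h.measure_sbaRow_scale_pos hH hP hnode (hV1.and (hV2.and hV3)) hW).trans_le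
    (measure_mono_ae ?_)
  filter_upwards [h.sbaWeight_ae_eq, h.eq_sum] with ω hω hsum hmem
  obtain ⟨⟨hm1, hm2, hm3⟩, hm4⟩ := hmem
  refine hclose (G ω) (fun l => sbaWeight (sbaArrayOfRow (sbaRow μ (n + 1) ω)) n l)
    (fun l => (μ (n + 1) (2 * l - 1) ω, φ l ω)) (fun l => ρ (l - 1))
    (fun l hl => ⟨hm1 l hl, hρ l hl, max_lt (hm2 ⟨l, hl⟩) (hm4 ⟨l, hl⟩)⟩)
    (fun a ha => by convert hm3 a ha) ?_
  rw [hsum]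
  exact Finset.sum_congr rfl fun l hl => by rw [hω l hl]

theorem theorem6
    (Θ : Set ℝ) (hΘ_closed : IsClosed Θ) (hΘ_interval : Θ.OrdConnected) (hΘ_nondeg : Θ.Nontrivial)
    {Ω : Type*} [MeasurableSpace Ω] (Pr : Measure Ω) [IsProbabilityMeasure Pr]
    (N : Ω → ℕ) (hN_meas : Measurable N) (hN_pos : ∀ᵐ ω ∂Pr, 1 ≤ N ω)
    (hN_full : ∀ n : ℕ, 1 ≤ n → 0 < Pr (N ⁻¹' {n}))
    (H : ℕ → ℕ → ℕ → ProbabilityMeasure Θ)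
    (hH_ac : ∀ n : ℕ, 1 ≤ n → ∀ j ∈ Finset.Icc 1 (n + 1), ∀ l ∈ Finset.Icc 1 (2 ^ (j - 1)),
      (H n j (2 * l - 1) : Measure Θ).map Subtype.val ≪ (volume : Measure ℝ))
    (hH_full : ∀ n : ℕ, 1 ≤ n → ∀ j ∈ Finset.Icc 1 (n + 1), ∀ l ∈ Finset.Icc 1 (2 ^ (j - 1)),
      (H n j (2 * l - 1) : Measure Θ).support = Set.univ)
    (P : ProbabilityMeasure ℝ≥0) (hP_full : (P : Measure ℝ≥0).support = Set.univ)
    (G : Ω → ProbabilityMeasure (Θ × ℝ≥0)) (hG_meas : AEMeasurable G Pr)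
    (hG : ∀ n : ℕ, 1 ≤ n → IsDSBASp (Pr[|N ⁻¹' {n}]) n (H n) P G) :
    (Pr.map G).support = Set.univ := by
  rw [Set.eq_univ_iff_forall]
  intro G₀
  rw [Measure.mem_support_iff_forall]
  intro U hU
  obtain ⟨U', hUU', hU', hG₀⟩ := mem_nhds_iff.1 hU
  obtain ⟨g₀, hg₀, s, p, hp, hint⟩ := exists_atomic_mem_of_isOpen G₀ hU' hG₀
  have hn : 1 ≤ s.card + 1 := by omega
  have := cond_isProbabilityMeasure (hN_full _ hn).ne'
  obtain ⟨μ, φ, h⟩ := hG _ hn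
  have hpos := h.measure_mem_nhds_atomic_pos hΘ_interval hΘ_nondeg hP_full hp hint
    (hU'.mem_nhds hg₀) (by omega) (hH_full _ hn)
  have hpos' : 0 < Pr (G ⁻¹' U') := by
    -- The conditional law is absolutely continuous with respect to `Pr`, so positivity passes back
    -- to `Pr`.
    refine pos_iff_ne_zero.2 fun h0 => hpos.ne' ?_
    exact cond_absolutelyContinuous h0
  exact hpos'.trans_le ((measure_mono (Set.preimage_mono hUU')).trans
    (Measure.le_map_apply hG_meas U))
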